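/- **Setting.** Let $N\in\mathbb N$ and let $\gamma:[0,1]\to\mathbb C$ be a regular $C^1$ parametrisation of an arc (also denoted $\gamma$) with $\gamma(0)=0$, $\gamma(1)=1$, meeting every circle centred at the origin at most once (for instance the segment $[0,1]$). Let $W:\gamma\setminus\{0,1\}\to\mathbb C^{N\times N}$ be a Jacobi-type matrix of weights: each entry is a finite sum of terms $$\varphi(z)\,z^{\alpha}(1-z)^{\beta}\log^{p}(z)\,\log^{q}(1-z),\qquad \operatorname{Re}\alpha,\operatorname{Re}\beta>-1,\ p,q\in\mathbb N,$$ with $\varphi$ entire and non-vanishing on $\gamma$, where logarithms and powers are taken with continuous determinations along $\gamma$. Assume that $W$ is regular, i.e. its moments $W_k=\frac1{2\pi i}\int_\gamma z^kW(z)\,dz$ satisfy $\det[W_{j+k}]_{j,k=0}^n\ne0$ for all $n\in\mathbb N$. Let $P_n^{L},P_n^{R}$ be the monic matrix polynomials of degree $n$, and $C_n$ the nonsingular matrix, such that for $k=0,\dots,n$ $$\frac1{2\pi i}\int_\gamma P_n^{L}(z)W(z)z^k\,dz=\delta_{n,k}C_n^{-1}=\frac1{2\pi i}\int_\gamma z^kW(z)P_n^{R}(z)\,dz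 ,$$ put $Q_n^{L}(z)=\frac1{2\pi i}\int_\gamma\frac{P_n^{L}(s)W(s)}{s-z}\,ds$, $Q_n^{R}(z)=\frac1{2\pi i}\int_\gamma\frac{W(s)P_n^{R}(s)}{s-z}\,ds$, and for $n\ge 0$ $$Y_n^{L}=\begin{bmatrix}P_n^{L}&Q_n^{L}\\-C_{n-1}P_{n-1}^{L}&-C_{n-1}Q_{n-1}^{L}\end{bmatrix},\qquad Y_n^{R}=\begin{bmatrix}P_n^{R}&-P_{n-1}^{R}C_{n-1}\\Q_n^{R}&-Q_{n-1}^{R}C_{n-1}\end{bmatrix},$$ where for $n=0$ the second block row of $Y_0^{L}$ is $[\,0\ \ I_N\,]$ and the second block column of $Y_0^{R}$ is $[\,0\ \ I_N\,]^{T}$. Let $h^{L},h^{R}$ be entire $N\times N$ matrix functions such that the Pearson equation $$z(1-z)W'(z)=h^{L}(z)W(z)+W(z)h^{R}(z)$$ holds on $\gamma\setminus\{0,1\}$. Suppose that $W$ admits a factorization $W=W^{L}W^{R}$: with $D=\mathbb C\setminus(\gamma\cup[1,+\infty))$, the matrix functions $W^{L},W^{R}$ are holomorphic and nonsingular on $D$,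 satisfy there $$z(1-z)(W^{L})'=h^{L}W^{L},\qquad z(1-z)(W^{R})'=W^{R}h^{R},$$ and the boundary value of $W^{L}W^{R}$ on $\gamma\setminus\{0,1\}$ from the left side of $\gamma$ (oriented from $0$ to $1$) is $W$. For $z\in D$ put $$Z_n^{L}=Y_n^{L}\begin{bmatrix}W^{L}&0\\0&(W^{R})^{-1}\end{bmatrix},\quad Z_n^{R}=\begin{bmatrix}W^{R}&0\\0&(W^{L})^{-1}\end{bmatrix}Y_n^{R},\quad M_n^{L}=(Z_n^{L})'(Z_n^{L})^{-1},\quad M_n^{R}=(Z_n^{R})^{-1}(Z_n^{R})'.$$ **Theorem.** For every $n\in\mathbb N$, $Z_n^{L}$ and $Z_n^{R}$ are holomorphic and nonsingular on $D$ (so that $M_n^{L}$, $M_n^{R}$ are well defined there), and $M_n^{L}$ and $M_n^{R}$ extend from $D$ to matrix functions meromorphic on $\mathbb C$ and holomorphic on $\mathbb C\setminus\{0,1\}$, each of the points $0$ and $1$ being a removable singularity or a simple pole. Consequently $z(1-z)M_n^{L}(z)$ and $z(1-z)M_n^{R}(z)$ extend to entire matrix functions. -/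

import Mathlib

open Set Filter Topology

noncomputable section

namespace JacobiRH

/-- The closed parameter interval of the curve. -/
abbrev unitI : Set ℝ := Set.Icc 0 1

/-- The velocity of the parametrised curve `γ` (one-sided at the two end points). -/
def vel (γ : ℝ → ℂ) (t : ℝ) : ℂ := derivWithin γ unitI t

/-- `γ` restricted to `[0,1]` is a regular `C¹` parametrisation of an arc from `0` to `1` that meets
each circle centred at the origin at most once; in particular the arc has no self-intersection.
(By the intermediate value theorem it meets each circle of radius `0 < R ≤ 1` exactly once.) -/
structure IsArc (γ : ℝ → ℂ) : Prop where
  smooth : ContDiffOn ℝ 1 γ unitI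
  vel_ne_zero : ∀ t ∈ unitI, vel γ t ≠ 0
  start : γ 0 = 0
  finish : γ 1 = 1
  circles : Set.InjOn (fun t => ‖γ t‖) unitI

/-- The plane cut along `γ` and the ray `[1, +∞)`; for `γ = [0,1]` this is `ℂ ∖ [0, +∞)`. -/
def cutPlane (γ : ℝ → ℂ) : Set ℂ :=
  {z | z ∉ γ '' unitI ∧ ∀ x : ℝ, 1 ≤ x → z ≠ (x : ℂ)}

section Entrywise

variable {m n : Type*}

/-- All entries of a matrix function are holomorphic on the set `s` (used for open `s`). -/
def HolomorphicOn (A : ℂ → Matrix m n ℂ) (s : Set ℂ) : Prop :=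
  ∀ i j, DifferentiableOn ℂ (fun z => A z i j) s

/-- The entrywise complex derivative of a matrix function. -/
def mderiv (A : ℂ → Matrix m n ℂ) (z : ℂ) : Matrix m n ℂ :=
  Matrix.of fun i j => deriv (fun w => A w i j) z

/-- `(1 / (2 π i)) ∫_γ f(z) dz`, where the integrand is given as a function of the parameter. -/
def arcIntegral (γ : ℝ → ℂ) (f : ℝ → Matrix m n ℂ) : Matrix m n ℂ :=
  Matrix.of fun i j =>
    (2 * (Real.pi : ℂ) * Complex.I)⁻¹ * ∫ t in (0 : ℝ)..1, f t i j * vel γ t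

/-- The derivative `W'(z)` at `z = γ t` of a matrix function on the curve, taken along the curve.
If `W` is the restriction of a function holomorphic near `γ t`, this is its complex derivative. -/
def derivAlong (γ : ℝ → ℂ) (W : ℂ → Matrix m n ℂ) (t : ℝ) : Matrix m n ℂ :=
  (vel γ t)⁻¹ • Matrix.of fun i j => deriv (fun s : ℝ => W (γ s) i j) t

end Entrywise

variable {N : ℕ}

/-- The moments `W_n` of the matrix of weights. -/
def moment (γ : ℝ → ℂ) (W : ℂ → Matrix (Fin N) (Fin N) ℂ) (n : ℕ) : Matrix (Fin N) (Fin N) ℂ :=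
  arcIntegral γ fun t => γ t ^ n • W (γ t)

/-- Regularity: all block Hankel determinants `det [W_{j+k}]_{j,k=0,…,n}` are nonzero. -/
def IsRegularWeight (γ : ℝ → ℂ) (W : ℂ → Matrix (Fin N) (Fin N) ℂ) : Prop :=
  ∀ n : ℕ, (Matrix.of fun (r s : Fin (n + 1) × Fin N) =>
    moment γ W ((r.1 : ℕ) + (s.1 : ℕ)) r.2 s.2).det ≠ 0

/-- Jacobi type matrix of weights on `γ`: with continuous determinations `ℓ₀` of `log z` and `ℓ₁` of
`log (1 - z)` along the curve, each entry is a finite sum of terms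
`φ z^α (1 - z)^β log^p z log^q (1 - z)` with `Re α, Re β > -1`, `p, q ∈ ℕ`, and `φ` entire and
nonvanishing on `γ` (hence also bounded and Hölder continuous on `γ`). -/
def IsJacobiType (γ : ℝ → ℂ) (W : ℂ → Matrix (Fin N) (Fin N) ℂ) : Prop :=
  ∃ ℓ₀ ℓ₁ : ℝ → ℂ,
    ContinuousOn ℓ₀ (Ioo 0 1) ∧ ContinuousOn ℓ₁ (Ioo 0 1) ∧
    (∀ t ∈ Ioo (0 : ℝ) 1, Complex.exp (ℓ₀ t) = γ t ∧ Complex.exp (ℓ₁ t) = 1 - γ t) ∧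
    ∀ j k : Fin N, ∃ (r : ℕ) (φ : Fin r → ℂ → ℂ) (α β : Fin r → ℂ) (p q : Fin r → ℕ),
      (∀ m, Differentiable ℂ (φ m) ∧ (∀ t ∈ unitI, φ m (γ t) ≠ 0) ∧
        -1 < (α m).re ∧ -1 < (β m).re) ∧
      ∀ t ∈ Ioo (0 : ℝ) 1, W (γ t) j k =
        ∑ m, φ m (γ t) * Complex.exp (α m * ℓ₀ t) * Complex.exp (β m * ℓ₁ t) *
          ℓ₀ t ^ p m * ℓ₁ t ^ q m

/-- The Pearson equation `z (1 - z) W' = hL W + W hR` on the curve. -/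
def PearsonEq (γ : ℝ → ℂ) (W hL hR : ℂ → Matrix (Fin N) (Fin N) ℂ) : Prop :=
  ∀ t ∈ Ioo (0 : ℝ) 1, (γ t * (1 - γ t)) • derivAlong γ W t =
    hL (γ t) * W (γ t) + W (γ t) * hR (γ t)

/-- The factorization `W = WL * WR`: the factors are holomorphic and nonsingular in the plane cut
along `γ` and `[1, +∞)`, they solve `z (1 - z) WL' = hL WL` and `z (1 - z) WR' = WR hR` there, and
the weight on `γ` is the boundary value of `WL * WR` from the positive (left) side of `γ`. -/
structure IsFactorization (γ : ℝ → ℂ) (W hL hR WL WR : ℂ → Matrix (Fin N) (Fin N) ℂ) :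
    Prop where
  holoL : HolomorphicOn WL (cutPlane γ)
  holoR : HolomorphicOn WR (cutPlane γ)
  nonsingL : ∀ z ∈ cutPlane γ, (WL z).det ≠ 0
  nonsingR : ∀ z ∈ cutPlane γ, (WR z).det ≠ 0
  pearsonL : ∀ z ∈ cutPlane γ, (z * (1 - z)) • mderiv WL z = hL z * WL z
  pearsonR : ∀ z ∈ cutPlane γ, (z * (1 - z)) • mderiv WR z = WR z * hR z
  boundary : ∀ t ∈ Ioo (0 : ℝ) 1,
    Tendsto (fun ε : ℝ => WL (γ t + ε * Complex.I * vel γ t) * WR (γ t + ε * Complex.I * vel γ t))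
      (𝓝[>] 0) (𝓝 (W (γ t)))

/-- The monic matrix polynomial `z^n I + ∑_{k<n} z^k c_k`. -/
def monicPoly {n : ℕ} (c : Fin n → Matrix (Fin N) (Fin N) ℂ) (z : ℂ) : Matrix (Fin N) (Fin N) ℂ :=
  z ^ n • (1 : Matrix (Fin N) (Fin N) ℂ) + ∑ k : Fin n, z ^ (k : ℕ) • c k

/-- Lower-order coefficients of the monic polynomials `P_n^L`, `P_n^R`, and the matrix `C_n`. -/
structure OrthData (N n : ℕ) where
  cL : Fin n → Matrix (Fin N) (Fin N) ℂ
  cR : Fin n → Matrix (Fin N) (Fin N) ℂ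
  C : Matrix (Fin N) (Fin N) ℂ

instance (N n : ℕ) : Nonempty (OrthData N n) := ⟨⟨0, 0, 0⟩⟩

/-- The orthogonality conditions of degree `n`: `C_n` is nonsingular and, for `k = 0, …, n`,
`(1/2πi) ∫ P_n^L W z^k dz = δ_{n,k} C_n⁻¹` and `(1/2πi) ∫ z^k W P_n^R dz = δ_{n,k} C_n⁻¹`. -/
def IsOrthogonal (γ : ℝ → ℂ) (W : ℂ → Matrix (Fin N) (Fin N) ℂ) {n : ℕ} (d : OrthData N n) :
    Prop :=
  d.C.det ≠ 0 ∧
  ∀ k ≤ n,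
    (arcIntegral γ (fun t => γ t ^ k • (monicPoly d.cL (γ t) * W (γ t))) =
      if k = n then d.C⁻¹ else 0) ∧
    (arcIntegral γ (fun t => γ t ^ k • (W (γ t) * monicPoly d.cR (γ t))) =
      if k = n then d.C⁻¹ else 0)

/-- The solution of the orthogonality conditions of degree `n` (for a regular matrix of weights it
exists and is unique). -/
def orthData (γ : ℝ → ℂ) (W : ℂ → Matrix (Fin N) (Fin N) ℂ) (n : ℕ) : OrthData N n :=
  Classical.epsilon fun d => IsOrthogonal γ W d

/-- The left orthogonal monic polynomial `P_n^L`. -/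
def PL (γ : ℝ → ℂ) (W : ℂ → Matrix (Fin N) (Fin N) ℂ) (n : ℕ) (z : ℂ) :
    Matrix (Fin N) (Fin N) ℂ :=
  monicPoly (orthData γ W n).cL z

/-- The right orthogonal monic polynomial `P_n^R`. -/
def PR (γ : ℝ → ℂ) (W : ℂ → Matrix (Fin N) (Fin N) ℂ) (n : ℕ) (z : ℂ) :
    Matrix (Fin N) (Fin N) ℂ :=
  monicPoly (orthData γ W n).cR z

/-- The matrix `C_n`. -/
def Cmat (γ : ℝ → ℂ) (W : ℂ → Matrix (Fin N) (Fin N) ℂ) (n : ℕ) : Matrix (Fin N) (Fin N) ℂ :=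
  (orthData γ W n).C

/-- The left second kind function `Q_n^L`. -/
def QL (γ : ℝ → ℂ) (W : ℂ → Matrix (Fin N) (Fin N) ℂ) (n : ℕ) (z : ℂ) :
    Matrix (Fin N) (Fin N) ℂ :=
  arcIntegral γ fun t => (γ t - z)⁻¹ • (PL γ W n (γ t) * W (γ t))

/-- The right second kind function `Q_n^R`. -/
def QR (γ : ℝ → ℂ) (W : ℂ → Matrix (Fin N) (Fin N) ℂ) (n : ℕ) (z : ℂ) :
    Matrix (Fin N) (Fin N) ℂ :=
  arcIntegral γ fun t => (γ t - z)⁻¹ • (W (γ t) * PR γ W n (γ t))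

/-- The matrix `Y_n^L`. For `n = 0` the conventions `P_{-1}^L = 0`, `Q_{-1}^L = -C_{-1}⁻¹` make the
second block row `(0, I)`. -/
def YL (γ : ℝ → ℂ) (W : ℂ → Matrix (Fin N) (Fin N) ℂ) :
    ℕ → ℂ → Matrix (Fin N ⊕ Fin N) (Fin N ⊕ Fin N) ℂ
  | 0, z => Matrix.fromBlocks (PL γ W 0 z) (QL γ W 0 z) 0 1
  | n + 1, z => Matrix.fromBlocks (PL γ W (n + 1) z) (QL γ W (n + 1) z)
      (-(Cmat γ W n * PL γ W n z)) (-(Cmat γ W n * QL γ W n z))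

/-- The matrix `Y_n^R`. For `n = 0` the conventions `P_{-1}^R = 0`, `Q_{-1}^R = -C_{-1}⁻¹` make the
second block column `(0, I)`. -/
def YR (γ : ℝ → ℂ) (W : ℂ → Matrix (Fin N) (Fin N) ℂ) :
    ℕ → ℂ → Matrix (Fin N ⊕ Fin N) (Fin N ⊕ Fin N) ℂ
  | 0, z => Matrix.fromBlocks (PR γ W 0 z) 0 (QR γ W 0 z) 1
  | n + 1, z => Matrix.fromBlocks (PR γ W (n + 1) z) (-(PR γ W n z * Cmat γ W n))
      (QR γ W (n + 1) z) (-(QR γ W n z * Cmat γ W n))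

/-- The constant jump fundamental matrix `Z_n^L = Y_n^L diag(WL, WR⁻¹)`. -/
def ZL (γ : ℝ → ℂ) (W WL WR : ℂ → Matrix (Fin N) (Fin N) ℂ) (n : ℕ) (z : ℂ) :
    Matrix (Fin N ⊕ Fin N) (Fin N ⊕ Fin N) ℂ :=
  YL γ W n z * Matrix.fromBlocks (WL z) 0 0 (WR z)⁻¹

/-- The constant jump fundamental matrix `Z_n^R = diag(WR, WL⁻¹) Y_n^R`. -/
def ZR (γ : ℝ → ℂ) (W WL WR : ℂ → Matrix (Fin N) (Fin N) ℂ) (n : ℕ) (z : ℂ) :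
    Matrix (Fin N ⊕ Fin N) (Fin N ⊕ Fin N) ℂ :=
  Matrix.fromBlocks (WR z) 0 0 (WL z)⁻¹ * YR γ W n z

/-- The left structure matrix `M_n^L = (Z_n^L)' (Z_n^L)⁻¹`. -/
def ML (γ : ℝ → ℂ) (W WL WR : ℂ → Matrix (Fin N) (Fin N) ℂ) (n : ℕ) (z : ℂ) :
    Matrix (Fin N ⊕ Fin N) (Fin N ⊕ Fin N) ℂ :=
  mderiv (ZL γ W WL WR n) z * (ZL γ W WL WR n z)⁻¹

/-- The right structure matrix `M_n^R = (Z_n^R)⁻¹ (Z_n^R)'`. -/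
def MR (γ : ℝ → ℂ) (W WL WR : ℂ → Matrix (Fin N) (Fin N) ℂ) (n : ℕ) (z : ℂ) :
    Matrix (Fin N ⊕ Fin N) (Fin N ⊕ Fin N) ℂ :=
  (ZR γ W WL WR n z)⁻¹ * mderiv (ZR γ W WL WR n) z

/-- The matrix function `M`, given on the set `D`, extends to a matrix function `F` that is
meromorphic on `ℂ` and holomorphic off `{0, 1}`, has at `0` and at `1` a removable singularity or a
simple pole (entrywise order at least `-1`), and for which `z (1 - z) F(z)` is (after removal of the
singularities at `0` and `1`) an entire function. -/
def ExtendsWithSimplePoles {m : Type*} (M : ℂ → Matrix m m ℂ) (D : Set ℂ) : Prop :=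
  ∃ F : ℂ → Matrix m m ℂ,
    Set.EqOn F M D ∧
    (∀ i j, MeromorphicOn (fun z => F z i j) Set.univ ∧
      AnalyticOnNhd ℂ (fun z => F z i j) {0, 1}ᶜ ∧
      -1 ≤ meromorphicOrderAt (fun z => F z i j) 0 ∧
      -1 ≤ meromorphicOrderAt (fun z => F z i j) 1) ∧
    ∃ E : ℂ → Matrix m m ℂ, HolomorphicOn E Set.univ ∧
      ∀ z, z ≠ 0 → z ≠ 1 → E z = (z * (1 - z)) • F z

end JacobiRH

end

open JacobiRH

/-!
The factors `WL` and `WR` play almost no role: the whole matter is the behaviour of the Cauchy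
transform `c(z) = (1 / 2πi) ∫_γ W(s) / (s - z) ds` off the arc.

* A Jacobi type weight is `O(t^(-a))` with `a < 1` at both ends of the arc (`IsTame`), because a
  continuous logarithm of a function vanishing to first order is `log t` plus a bounded function
  (`isTame_exp_mul_pow`). So `W` is integrable and `z (1 - z) W` vanishes at the end points.
* If `F` is entire then `∫ F(s) W(s) / (s - z) ds` and `F(z) ∫ W(s) / (s - z) ds` differ by
  `∫ (F(s) - F(z)) / (s - z) W(s) ds`, which is entire (`differentiable_integral_dslope`).
  Integrating by parts, the Pearson equation on the arc therefore gives
  `z (1 - z) c' = hL c + c hR + R` with `R` entire (`exists_entire_pearson_cauchyTransform`).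
* For the polynomials `P_n` the same remark gives `Q_n^L = P_n^L c + E_n^L`, with `E_n^L` the
  polynomial of the second kind, so `Y_n^L = S [1 c; 0 1]` with `S` polynomial (`YL_eq`), and
  likewise `J Y_n^R J⁻¹ = [1 -c; 0 1] T` with `T` polynomial (`YR_eq`), where `J = [0 1; -1 0]`. The
  biorthogonality relations say exactly that `S T = 1` (`polyFactor_mul_inv`).

Hence on the cut plane `Z_n^L = S V` with `V = [1 c; 0 1] diag(WL, WR⁻¹)`, and
`z (1 - z) V' = [hL R; 0 -hR] V` (`hasMDerivAt_cauchyFactor`). So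
`z (1 - z) M_n^L = z (1 - z) S' T + S [hL R; 0 -hR] T`, which is entire. Finally
`Z_n^R = J⁻¹ (Z_n^L)⁻¹ J`, so `M_n^R = -J⁻¹ M_n^L J`.
-/

namespace JacobiRH

open MeasureTheory Asymptotics

/-! ### Entrywise calculus of matrix functions -/

section MatrixCalculus

variable {l m n : Type*}

/-- The matrix function `A` has entrywise complex derivative `A'` at `z`. -/
def HasMDerivAt (A : ℂ → Matrix m n ℂ) (A' : Matrix m n ℂ) (z : ℂ) : Prop :=
  ∀ i j, HasDerivAt (fun w => A w i j) (A' i j) z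

lemma HasMDerivAt.mderiv {A : ℂ → Matrix m n ℂ} {A' : Matrix m n ℂ} {z : ℂ}
    (h : HasMDerivAt A A' z) : mderiv A z = A' := by
  ext i j
  exact (h i j).deriv

lemma HolomorphicOn.hasMDerivAt {A : ℂ → Matrix m n ℂ} {s : Set ℂ} (h : HolomorphicOn A s)
    (hs : IsOpen s) {z : ℂ} (hz : z ∈ s) : HasMDerivAt A (JacobiRH.mderiv A z) z := fun i j =>
  ((h i j).differentiableAt (hs.mem_nhds hz)).hasDerivAt

lemma holomorphicOn_of_hasMDerivAt {A A' : ℂ → Matrix m n ℂ} {s : Set ℂ}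
    (h : ∀ z ∈ s, HasMDerivAt A (A' z) z) : HolomorphicOn A s := fun i j z hz =>
  (h z hz i j).differentiableAt.differentiableWithinAt

lemma HasMDerivAt.congr_of_eventuallyEq {A B : ℂ → Matrix m n ℂ} {A' : Matrix m n ℂ} {z : ℂ}
    (h : HasMDerivAt A A' z) (hB : B =ᶠ[𝓝 z] A) : HasMDerivAt B A' z := fun i j =>
  (h i j).congr_of_eventuallyEq (hB.mono fun w hw => by simp only [hw])

lemma hasMDerivAt_const (A : Matrix m n ℂ) (z : ℂ) : HasMDerivAt (fun _ => A) 0 z := fun i j =>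
  hasDerivAt_const z (A i j)

lemma HasMDerivAt.mul [Fintype m] {A : ℂ → Matrix l m ℂ} {B : ℂ → Matrix m n ℂ}
    {A' : Matrix l m ℂ} {B' : Matrix m n ℂ} {z : ℂ} (hA : HasMDerivAt A A' z)
    (hB : HasMDerivAt B B' z) :
    HasMDerivAt (fun w => A w * B w) (A' * B z + A z * B') z := fun i j => by
  simp only [Matrix.mul_apply, Matrix.add_apply, ← Finset.sum_add_distrib]
  exact HasDerivAt.fun_sum fun k _ => (hA i k).mul (hB k j)

lemma HasMDerivAt.fromBlocks {o : Type*} {A : ℂ → Matrix n l ℂ} {B : ℂ → Matrix n m ℂ}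
    {C : ℂ → Matrix o l ℂ} {D : ℂ → Matrix o m ℂ} {A' : Matrix n l ℂ} {B' : Matrix n m ℂ}
    {C' : Matrix o l ℂ} {D' : Matrix o m ℂ} {z : ℂ} (hA : HasMDerivAt A A' z)
    (hB : HasMDerivAt B B' z) (hC : HasMDerivAt C C' z) (hD : HasMDerivAt D D' z) :
    HasMDerivAt (fun w => Matrix.fromBlocks (A w) (B w) (C w) (D w))
      (Matrix.fromBlocks A' B' C' D') z := by
  rintro (i | i) (j | j)
  exacts [hA i j, hB i j, hC i j, hD i j]

lemma differentiableAt_det [Fintype m] [DecidableEq m] {A : ℂ → Matrix m m ℂ} {z : ℂ}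
    (h : ∀ i j, DifferentiableAt ℂ (fun w => A w i j) z) :
    DifferentiableAt ℂ (fun w => (A w).det) z := by
  simp only [Matrix.det_apply]
  refine DifferentiableAt.fun_sum fun σ _ => DifferentiableAt.const_smul ?_ _
  exact DifferentiableAt.fun_finsetProd fun i _ => h _ _

/-- Entries of the adjugate are determinants, so Cramer's rule makes `A⁻¹` differentiable; its
derivative is then read off from `A * A⁻¹ = 1`. -/
lemma HasMDerivAt.inv [Fintype m] [DecidableEq m] {A : ℂ → Matrix m m ℂ} {A' : Matrix m m ℂ}
    {z : ℂ} (hA : HasMDerivAt A A' z) (hdet : (A z).det ≠ 0) :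
    HasMDerivAt (fun w => (A w)⁻¹) (-((A z)⁻¹ * A' * (A z)⁻¹)) z := by
  have hd : DifferentiableAt ℂ (fun w => (A w).det) z :=
    differentiableAt_det fun i j => (hA i j).differentiableAt
  have hinv : ∀ i j, DifferentiableAt ℂ (fun w => (A w)⁻¹ i j) z := by
    intro i j
    have h1 : (fun w => (A w)⁻¹ i j) =
        fun w => (A w).det⁻¹ * ((A w).updateRow j (Pi.single i 1)).det := by
      funext w
      rw [Matrix.inv_def, Matrix.smul_apply, Matrix.adjugate_apply, Ring.inverse_eq_inv',
        smul_eq_mul]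
    rw [h1]
    refine (hd.inv hdet).mul (differentiableAt_det fun a b => ?_)
    by_cases ha : a = j
    · subst ha
      simp only [Matrix.updateRow_self]
      exact differentiableAt_const _
    · simp only [Matrix.updateRow_ne ha]
      exact (hA a b).differentiableAt
  have hB : HasMDerivAt (fun w => (A w)⁻¹) (JacobiRH.mderiv (fun w => (A w)⁻¹) z) z := fun i j =>
    (hinv i j).hasDerivAt
  have hev : (fun w => A w * (A w)⁻¹) =ᶠ[𝓝 z] fun _ => 1 := by
    filter_upwards [hd.continuousAt.eventually_ne hdet] with w hw
    exact Matrix.mul_nonsing_inv _ (isUnit_iff_ne_zero.2 hw)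
  have h0 := (hA.mul hB).mderiv.symm.trans
    ((hasMDerivAt_const 1 z).congr_of_eventuallyEq hev).mderiv
  have hu : (A z)⁻¹ * A z = 1 := Matrix.nonsing_inv_mul _ (isUnit_iff_ne_zero.2 hdet)
  have h1 : JacobiRH.mderiv (fun w => (A w)⁻¹) z = -((A z)⁻¹ * A' * (A z)⁻¹) := by
    have h2 := congrArg (fun X => (A z)⁻¹ * X) h0
    simp only [Matrix.mul_add, ← Matrix.mul_assoc, hu, Matrix.one_mul, Matrix.mul_zero] at h2
    exact eq_neg_of_add_eq_zero_right h2
  rwa [h1] at hB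

lemma HolomorphicOn.mul [Fintype m] {A : ℂ → Matrix l m ℂ} {B : ℂ → Matrix m n ℂ} {s : Set ℂ}
    (hA : HolomorphicOn A s) (hB : HolomorphicOn B s) :
    HolomorphicOn (fun z => A z * B z) s := fun i j => by
  simp only [Matrix.mul_apply]
  exact DifferentiableOn.fun_sum fun k _ => (hA i k).mul (hB k j)

lemma HolomorphicOn.add {A B : ℂ → Matrix m n ℂ} {s : Set ℂ}
    (hA : HolomorphicOn A s) (hB : HolomorphicOn B s) :
    HolomorphicOn (fun z => A z + B z) s := fun i j => (hA i j).add (hB i j)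

lemma HolomorphicOn.neg {A : ℂ → Matrix m n ℂ} {s : Set ℂ}
    (hA : HolomorphicOn A s) : HolomorphicOn (fun z => -A z) s := fun i j => (hA i j).neg

lemma HolomorphicOn.smul {f : ℂ → ℂ} {A : ℂ → Matrix m n ℂ} {s : Set ℂ}
    (hf : DifferentiableOn ℂ f s) (hA : HolomorphicOn A s) :
    HolomorphicOn (fun z => f z • A z) s := fun i j => hf.mul (hA i j)

lemma holomorphicOn_const (A : Matrix m n ℂ) (s : Set ℂ) : HolomorphicOn (fun _ => A) s :=
  fun _ _ => differentiableOn_const _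

lemma HolomorphicOn.sum {ι : Type*} {t : Finset ι} {A : ι → ℂ → Matrix m n ℂ} {s : Set ℂ}
    (h : ∀ k ∈ t, HolomorphicOn (A k) s) : HolomorphicOn (fun z => ∑ k ∈ t, A k z) s :=
    fun i j => by
  simp only [Matrix.sum_apply]
  exact DifferentiableOn.fun_sum fun k hk => h k hk i j

lemma HolomorphicOn.fromBlocks {o : Type*} {A : ℂ → Matrix n l ℂ} {B : ℂ → Matrix n m ℂ}
    {C : ℂ → Matrix o l ℂ} {D : ℂ → Matrix o m ℂ} {s : Set ℂ} (hA : HolomorphicOn A s)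
    (hB : HolomorphicOn B s) (hC : HolomorphicOn C s) (hD : HolomorphicOn D s) :
    HolomorphicOn (fun w => Matrix.fromBlocks (A w) (B w) (C w) (D w)) s := by
  rintro (i | i) (j | j)
  exacts [hA i j, hB i j, hC i j, hD i j]

lemma HolomorphicOn.mderiv {A : ℂ → Matrix m n ℂ} (hA : HolomorphicOn A Set.univ) :
    HolomorphicOn (JacobiRH.mderiv A) Set.univ := fun i j =>
  (hA i j).deriv isOpen_univ

end MatrixCalculus

/-! ### Integrals depending holomorphically on a parameter -/

/-- Differentiation under the integral sign for a kernel that is holomorphic in the parameter: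
local boundedness of the kernel suffices, as Cauchy's estimate bounds its derivative. -/
lemma hasDerivAt_integral_mul_of_locallyBounded {w : ℝ → ℂ}
    (hw : IntervalIntegrable w volume 0 1) {K : ℝ → ℂ → ℂ} {U : Set ℂ} (hU : IsOpen U)
    (hd : ∀ t ∈ unitI, DifferentiableOn ℂ (K t) U)
    (hm : ∀ z ∈ U, ContinuousOn (fun t => K t z) unitI)
    (hb : ∀ z ∈ U, ∃ ε > 0, ∃ M, ∀ t ∈ unitI, ∀ y ∈ Metric.ball z ε, ‖K t y‖ ≤ M)
    {z : ℂ} (hz : z ∈ U) :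
    HasDerivAt (fun y => ∫ t in (0 : ℝ)..1, K t y * w t)
      (∫ t in (0 : ℝ)..1, deriv (K t) z * w t) z := by
  obtain ⟨ε₁, hε₁, M, hM⟩ := hb z hz
  obtain ⟨ε₂, hε₂, hball⟩ := Metric.isOpen_iff.1 hU z hz
  obtain ⟨ε, hε, hle₁, hle₂⟩ : ∃ ε > 0, ε ≤ ε₁ ∧ ε ≤ ε₂ :=
    ⟨min ε₁ ε₂, lt_min hε₁ hε₂, min_le_left _ _, min_le_right _ _⟩
  have hIoc : Set.uIoc (0 : ℝ) 1 = Ioc 0 1 := Set.uIoc_of_le zero_le_one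
  have hsub : Ioc (0 : ℝ) 1 ⊆ unitI := Ioc_subset_Icc_self
  have hwm : AEStronglyMeasurable w (volume.restrict (Set.uIoc 0 1)) := by
    rw [hIoc]; exact hw.1.aestronglyMeasurable
  have hKm : ∀ y ∈ U, AEStronglyMeasurable (fun t => K t y) (volume.restrict (Set.uIoc 0 1)) := by
    intro y hy
    rw [hIoc]
    exact ((hm y hy).mono hsub).aestronglyMeasurable measurableSet_Ioc
  have hdiff : ∀ t ∈ unitI, ∀ y ∈ U, DifferentiableAt ℂ (K t) y := fun t ht y hy =>
    (hd t ht).differentiableAt (hU.mem_nhds hy)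
  have hder : ∀ t ∈ unitI, ∀ y ∈ Metric.ball z (ε / 2), ‖deriv (K t) y‖ ≤ M / (ε / 4) := by
    intro t ht y hy
    have hcl : Metric.closedBall y (ε / 4) ⊆ Metric.ball z ε := by
      intro x hx
      simp only [Metric.mem_closedBall, Metric.mem_ball] at *
      linarith [dist_triangle x y z]
    refine Complex.norm_deriv_le_of_forall_mem_sphere_norm_le (by positivity) ?_ ?_
    · refine DifferentiableOn.diffContOnCl ?_
      rw [closure_ball _ (by positivity)]
      exact (hd t ht).mono (hcl.trans ((Metric.ball_subset_ball hle₂).trans hball))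
    · intro x hx
      exact hM t ht x (Metric.ball_subset_ball hle₁ (hcl (Metric.sphere_subset_closedBall hx)))
  have hK'm : AEStronglyMeasurable (fun t => deriv (K t) z) (volume.restrict (Set.uIoc 0 1)) := by
    -- the derivative is a pointwise limit of difference quotients along `z + (ε / 2) / (k + 1)`
    let h : ℕ → ℂ := fun k => ((ε / 2 / (k + 1 : ℝ) : ℝ) : ℂ)
    have hh : ∀ k, z + h k ∈ U := by
      intro k
      refine hball (Metric.mem_ball.2 ?_)
      have h1 : ε / 2 / (k + 1 : ℝ) ≤ ε / 2 :=
        div_le_self (by positivity) (by linarith [k.cast_nonneg (α := ℝ)])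
      have h2 : (0 : ℝ) ≤ ε / 2 / (k + 1 : ℝ) := by positivity
      simp only [dist_eq_norm, add_sub_cancel_left, h, Complex.norm_real, Real.norm_eq_abs,
        abs_of_nonneg h2]
      linarith
    have hlim : Tendsto h atTop (𝓝[≠] 0) := by
      refine tendsto_nhdsWithin_iff.2 ⟨?_, Eventually.of_forall fun k => ?_⟩
      · have h1 : Tendsto (fun k : ℕ => ε / 2 / (k + 1 : ℝ)) atTop (𝓝 0) :=
          tendsto_const_nhds.div_atTop (tendsto_natCast_atTop_atTop.atTop_add tendsto_const_nhds)
        rw [← Complex.ofReal_zero]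
        exact (Complex.continuous_ofReal.tendsto 0).comp h1
      · have : (0 : ℝ) < ε / 2 / (k + 1 : ℝ) := by positivity
        simp only [h, mem_compl_iff, mem_singleton_iff, Complex.ofReal_eq_zero]
        exact this.ne'
    refine aestronglyMeasurable_of_tendsto_ae (u := atTop)
      (f := fun (k : ℕ) t => (h k)⁻¹ • (K t (z + h k) - K t z))
      (fun k => ((hKm _ (hh k)).sub (hKm z hz)).const_smul (h k)⁻¹) ?_
    rw [hIoc]
    filter_upwards [ae_restrict_mem measurableSet_Ioc] with t ht
    exact (hasDerivAt_iff_tendsto_slope_zero.1 (hdiff t (hsub ht) z hz).hasDerivAt).comp hlim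
  refine (intervalIntegral.hasDerivAt_integral_of_dominated_loc_of_deriv_le
    (F := fun y t => K t y * w t) (F' := fun y t => deriv (K t) y * w t)
    (bound := fun t => M / (ε / 4) * ‖w t‖) (s := Metric.ball z (ε / 2))
    (Metric.ball_mem_nhds _ (by positivity)) ?_ ?_ (hK'm.mul hwm) ?_ (hw.norm.const_mul _) ?_).2
  · filter_upwards [hU.mem_nhds hz] with y hy
    exact (hKm y hy).mul hwm
  · refine hw.continuousOn_mul ?_
    rw [Set.uIcc_of_le zero_le_one]
    exact hm z hz
  · refine Eventually.of_forall fun t ht y hy => ?_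
    rw [hIoc] at ht
    rw [norm_mul]
    exact mul_le_mul_of_nonneg_right (hder t (hsub ht) y hy) (norm_nonneg _)
  · refine Eventually.of_forall fun t ht y hy => ?_
    rw [hIoc] at ht
    have hy' : y ∈ U := hball (Metric.ball_subset_ball (by linarith) hy)
    exact (hdiff t (hsub ht) y hy').hasDerivAt.mul_const _

lemma dslope_comm (f : ℂ → ℂ) (a b : ℂ) : dslope f a b = dslope f b a := by
  rcases eq_or_ne a b with rfl | h
  · rfl
  · rw [dslope_of_ne f h.symm, dslope_of_ne f h, slope_comm]

/-- Divided differences of an entire function against an integrable weight on a compact curve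
form an entire function. -/
lemma differentiable_integral_dslope {γ : ℝ → ℂ} (hγ : ContinuousOn γ unitI) {w : ℝ → ℂ}
    (hw : IntervalIntegrable w volume 0 1) {f : ℂ → ℂ} (hf : Differentiable ℂ f) :
    Differentiable ℂ fun z => ∫ t in (0 : ℝ)..1, dslope f (γ t) z * w t := by
  have hds : ∀ a, Differentiable ℂ (dslope f a) := fun a => by
    rw [← differentiableOn_univ] at hf ⊢
    exact (Complex.differentiableOn_dslope univ_mem).2 hf
  intro z
  refine (hasDerivAt_integral_mul_of_locallyBounded hw (K := fun t z => dslope f (γ t) z)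
    isOpen_univ (fun t _ => (hds _).differentiableOn) ?_ ?_ (mem_univ z)).differentiableAt
  · intro y _
    simp only [dslope_comm f _ y]
    exact (hds y).continuous.comp_continuousOn hγ
  · intro y _
    obtain ⟨ρ₁, hρ₁⟩ := (isCompact_Icc.image_of_continuousOn hγ).isBounded.subset_closedBall (0 : ℂ)
    let ρ := max ρ₁ (‖y‖ + 1)
    obtain ⟨M, hM⟩ := (isCompact_closedBall (0 : ℂ) ρ).exists_bound_of_continuousOn
      ((hf.contDiff (n := 1)).continuous_deriv le_rfl).continuousOn
    refine ⟨1, one_pos, M, fun t ht x hx => ?_⟩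
    have ha : γ t ∈ Metric.closedBall (0 : ℂ) ρ :=
      Metric.closedBall_subset_closedBall (le_max_left _ _) (hρ₁ (mem_image_of_mem γ ht))
    have hx' : x ∈ Metric.closedBall (0 : ℂ) ρ := by
      rw [mem_closedBall_zero_iff]
      rw [Metric.mem_ball, dist_eq_norm] at hx
      have := norm_add_le (x - y) y
      rw [sub_add_cancel] at this
      exact le_trans (by linarith) (le_max_right ρ₁ _)
    rcases eq_or_ne x (γ t) with rfl | hne
    · rw [dslope_same]; exact hM _ ha
    · rw [dslope_of_ne f hne, slope_def_field, norm_div,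
        div_le_iff₀ (norm_pos_iff.2 (sub_ne_zero.2 hne))]
      exact (convex_closedBall (0 : ℂ) ρ).norm_image_sub_le_of_norm_deriv_le
        (fun u _ => hf u) hM ha hx'

/-- The Cauchy-type integral of an integrable weight over a compact curve is holomorphic off the
curve, and may be differentiated under the integral sign. -/
lemma hasDerivAt_integral_inv_sub {γ : ℝ → ℂ} (hγ : ContinuousOn γ unitI) {w : ℝ → ℂ}
    (hw : IntervalIntegrable w volume 0 1) {z : ℂ} (hz : z ∉ γ '' unitI) :
    HasDerivAt (fun y => ∫ t in (0 : ℝ)..1, (γ t - y)⁻¹ * w t)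
      (∫ t in (0 : ℝ)..1, ((γ t - z) ^ 2)⁻¹ * w t) z := by
  have hcl : IsClosed (γ '' unitI) := (isCompact_Icc.image_of_continuousOn hγ).isClosed
  have hne : ∀ t ∈ unitI, ∀ y ∈ (γ '' unitI)ᶜ, γ t - y ≠ 0 := fun t ht y hy h =>
    hy ⟨t, ht, sub_eq_zero.1 h⟩
  have hder : ∀ t ∈ unitI, ∀ y ∈ (γ '' unitI)ᶜ,
      HasDerivAt (fun y => (γ t - y)⁻¹) ((γ t - y) ^ 2)⁻¹ y := by
    intro t ht y hy
    have := ((hasDerivAt_id y).const_sub (γ t)).inv (hne t ht y hy)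
    rwa [neg_neg, one_div] at this
  have key := hasDerivAt_integral_mul_of_locallyBounded hw (K := fun t y => (γ t - y)⁻¹)
    hcl.isOpen_compl (fun t ht y hy => (hder t ht y hy).differentiableAt.differentiableWithinAt)
    (fun y hy => (hγ.sub continuousOn_const).inv₀ fun t ht => hne t ht y hy) ?_ hz
  · convert key using 1
    refine intervalIntegral.integral_congr fun t ht => ?_
    rw [Set.uIcc_of_le zero_le_one] at ht
    simp only [(hder t ht z hz).deriv]
  · intro y hy
    obtain ⟨ε, hε, hball⟩ := Metric.isOpen_iff.1 hcl.isOpen_compl y hy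
    refine ⟨ε / 2, by positivity, (ε / 2)⁻¹, fun t ht x hx => ?_⟩
    rw [norm_inv]
    refine inv_anti₀ (by positivity) ?_
    by_contra! hlt
    refine hball (a := γ t) ?_ ⟨t, ht, rfl⟩
    rw [Metric.mem_ball] at hx ⊢
    rw [← dist_eq_norm] at hlt
    linarith [dist_triangle (γ t) x y]

/-! ### Continuous logarithms along a curve -/

lemma isDiscrete_range_intCast : IsDiscrete (Set.range ((↑) : ℤ → ℝ)) :=
  ⟨Int.isClosedEmbedding_coe_real.isEmbedding.toHomeomorph.symm.isEmbedding.discreteTopology⟩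

/-- A continuous logarithm of a function with a finite nonzero limit stays bounded: it differs
from the principal logarithm of the normalised function by a continuous function with values in
the discrete set `2πiℤ`, hence by a constant. -/
lemma isBigO_one_of_exp_eq {ℓ f : ℝ → ℂ} (hℓ : ContinuousOn ℓ (Ioo 0 1))
    (hexp : ∀ t ∈ Ioo (0 : ℝ) 1, Complex.exp (ℓ t) = f t) {c : ℂ} (hc : c ≠ 0)
    (hf : Tendsto f (𝓝[>] 0) (𝓝 c)) : ℓ =O[𝓝[>] 0] fun _ => (1 : ℝ) := by
  have h1 : Tendsto (fun t => f t / c) (𝓝[>] 0) (𝓝 1) := by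
    simpa [div_self hc] using hf.div_const c
  have h2 : Tendsto (fun t => Complex.log (f t / c)) (𝓝[>] 0) (𝓝 0) := by
    have := (continuousAt_clog Complex.one_mem_slitPlane).tendsto.comp h1
    rwa [Complex.log_one] at this
  have h3 : ∀ᶠ t in 𝓝[>] (0 : ℝ), f t / c ∈ Complex.slitPlane ∧ t < 1 :=
    (h1.eventually (Complex.isOpen_slitPlane.mem_nhds Complex.one_mem_slitPlane)).and
      (nhdsWithin_le_nhds (Iio_mem_nhds one_pos))
  obtain ⟨δ, hδ, hsub⟩ := mem_nhdsGT_iff_exists_Ioc_subset.1 h3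
  have hI : ∀ t ∈ Ioc 0 δ, t ∈ Ioo (0 : ℝ) 1 := fun t ht => ⟨ht.1, (hsub ht).2⟩
  let g : ℝ → ℂ := fun t => ℓ t - Complex.log (f t / c) - Complex.log c
  have hfc : ContinuousOn f (Ioc 0 δ) :=
    ((Complex.continuous_exp.comp_continuousOn hℓ).mono hI).congr fun t ht =>
      (hexp t (hI t ht)).symm
  have hg : ContinuousOn g (Ioc 0 δ) :=
    ((hℓ.mono hI).sub ((hfc.div_const c).clog fun t ht => (hsub ht).1)).sub continuousOn_const
  have hg1 : ∀ t ∈ Ioc 0 δ, ∃ n : ℤ, g t = n * (2 * Real.pi * Complex.I) := by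
    intro t ht
    rw [← Complex.exp_eq_one_iff]
    have hft : f t ≠ 0 := hexp t (hI t ht) ▸ Complex.exp_ne_zero _
    rw [Complex.exp_sub, Complex.exp_sub, hexp t (hI t ht), Complex.exp_log (div_ne_zero hft hc),
      Complex.exp_log hc]
    field_simp
  have hconst : ∀ t ∈ Ioc 0 δ, g t = g δ := by
    intro t ht
    have hδ' : δ ∈ Ioc 0 δ := ⟨hδ, le_rfl⟩
    have him : (g t).im / (2 * Real.pi) = (g δ).im / (2 * Real.pi) := by
      refine isPreconnected_Ioc.constant_of_mapsTo (f := fun t => (g t).im / (2 * Real.pi))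
        isDiscrete_range_intCast ((Complex.continuous_im.comp_continuousOn hg).div_const _)
        ?_ ht hδ'
      intro s hs
      obtain ⟨n, hn⟩ := hg1 s hs
      refine ⟨n, ?_⟩
      have hpi := Real.pi_ne_zero
      simp [hn]
    have him' : (g t).im = (g δ).im := by
      rwa [div_left_inj' (by positivity)] at him
    obtain ⟨n, hn⟩ := hg1 t ht
    obtain ⟨k, hk⟩ := hg1 δ hδ'
    refine Complex.ext ?_ him'
    simp [hn, hk]
  have hev : ℓ =ᶠ[𝓝[>] 0] fun t => g δ + Complex.log c + Complex.log (f t / c) := by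
    filter_upwards [Ioc_mem_nhdsGT hδ] with t ht
    rw [← hconst t ht]
    simp only [g]
    ring
  exact ((tendsto_const_nhds.add h2).congr' hev.symm).isBigO_one ℝ

/-- Near a point where it is continuous, a logarithm of a differentiable function is the principal
logarithm of a quotient plus a constant. -/
lemma differentiableAt_of_exp_eq {ℓ f : ℝ → ℂ} {t : ℝ} (hℓ : ContinuousAt ℓ t)
    (hexp : ∀ᶠ s in 𝓝 t, Complex.exp (ℓ s) = f s) (hf : DifferentiableAt ℝ f t) :
    DifferentiableAt ℝ ℓ t := by
  have h0 : f t ≠ 0 := hexp.self_of_nhds ▸ Complex.exp_ne_zero _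
  have him : Tendsto (fun s => (ℓ s - ℓ t).im) (𝓝 t) (𝓝 0) := by
    have : ContinuousAt (fun s => (ℓ s - ℓ t).im) t :=
      Complex.continuous_im.continuousAt.comp (hℓ.sub continuousAt_const)
    simpa [ContinuousAt] using this
  have hev : ℓ =ᶠ[𝓝 t] fun s => ℓ t + Complex.log (f s / f t) := by
    filter_upwards [hexp, him.eventually (Ioo_mem_nhds (neg_neg_iff_pos.2 Real.pi_pos) Real.pi_pos)]
      with s hs hs'
    rw [← hs, ← hexp.self_of_nhds, ← Complex.exp_sub, Complex.log_exp hs'.1 hs'.2.le]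
    ring
  refine DifferentiableAt.congr_of_eventuallyEq ?_ hev
  refine (differentiableAt_const _).add ?_
  have hd : HasDerivAt (fun s => f s / f t) (deriv f t / f t) t := hf.hasDerivAt.div_const _
  exact (hd.clog_real (by rw [div_self h0]; exact Complex.one_mem_slitPlane)).differentiableAt

/-! ### Growth of Jacobi type weights at the end points -/

/-- Near `0+` the function is dominated by an integrable power of the variable. -/
def IsTame (f : ℝ → ℂ) : Prop :=
  ∃ a : ℝ, a < 1 ∧ f =O[𝓝[>] 0] fun t : ℝ => t ^ (-a)

lemma rpow_neg_isBigO_rpow_neg {a b : ℝ} (h : a ≤ b) :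
    (fun t : ℝ => t ^ (-a)) =O[𝓝[>] 0] fun t : ℝ => t ^ (-b) := by
  refine IsBigO.of_bound 1 ?_
  filter_upwards [Ioc_mem_nhdsGT one_pos] with t ht
  rw [one_mul, Real.norm_of_nonneg (Real.rpow_nonneg ht.1.le _),
    Real.norm_of_nonneg (Real.rpow_nonneg ht.1.le _)]
  exact Real.rpow_le_rpow_of_exponent_ge ht.1 ht.2 (by linarith)

lemma IsTame.add {f g : ℝ → ℂ} (hf : IsTame f) (hg : IsTame g) : IsTame (f + g) := by
  obtain ⟨a, ha, hfa⟩ := hf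
  obtain ⟨b, hb, hgb⟩ := hg
  exact ⟨max a b, max_lt ha hb,
    (hfa.trans (rpow_neg_isBigO_rpow_neg (le_max_left a b))).add
      (hgb.trans (rpow_neg_isBigO_rpow_neg (le_max_right a b)))⟩

lemma isTame_zero : IsTame 0 := ⟨0, one_pos, isBigO_zero _ _⟩

lemma IsTame.congr {f g : ℝ → ℂ} (hf : IsTame f) (h : ∀ t ∈ Ioo (0 : ℝ) 1, g t = f t) :
    IsTame g := by
  obtain ⟨a, ha, hfa⟩ := hf
  refine ⟨a, ha, hfa.congr' ?_ EventuallyEq.rfl⟩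
  filter_upwards [Ioo_mem_nhdsGT one_pos] with t ht
  exact (h t ht).symm

lemma IsTame.bounded_mul {f g : ℝ → ℂ} (hf : IsTame f) (hg : g =O[𝓝[>] 0] fun _ => (1 : ℝ)) :
    IsTame (g * f) := by
  obtain ⟨a, ha, hfa⟩ := hf
  exact ⟨a, ha, (hg.mul hfa).congr_right fun t => one_mul _⟩

lemma IsTame.tendsto_mul {f g : ℝ → ℂ} (hf : IsTame f) (hg : g =O[𝓝[>] 0] fun t : ℝ => t) :
    Tendsto (fun t => g t * f t) (𝓝[>] 0) (𝓝 0) := by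
  obtain ⟨a, ha, hfa⟩ := hf
  have h1 : (fun t => g t * f t) =O[𝓝[>] 0] fun t : ℝ => t ^ (1 - a) := by
    refine (hg.mul hfa).congr' EventuallyEq.rfl ?_
    filter_upwards [self_mem_nhdsWithin] with t ht
    rw [sub_eq_add_neg, Real.rpow_add ht, Real.rpow_one]
  refine h1.trans_tendsto ?_
  have h2 : ContinuousAt (fun t : ℝ => t ^ (1 - a)) 0 :=
    Real.continuousAt_rpow_const _ _ (Or.inr (by linarith))
  have h3 := h2.tendsto
  rw [Real.zero_rpow (by linarith)] at h3
  exact h3.mono_left nhdsWithin_le_nhds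

lemma exp_mul_isBigO_one {ℓ : ℝ → ℂ} {l : Filter ℝ} (hℓ : ℓ =O[l] fun _ => (1 : ℝ)) (α : ℂ) :
    (fun t => Complex.exp (α * ℓ t)) =O[l] fun _ => (1 : ℝ) := by
  obtain ⟨B, hB⟩ := hℓ.bound
  refine IsBigO.of_bound (Real.exp (‖α‖ * B)) ?_
  filter_upwards [hB] with t ht
  rw [norm_one, mul_one] at ht ⊢
  refine (Complex.norm_exp_le_exp_norm _).trans (Real.exp_le_exp.2 ?_)
  rw [norm_mul]
  exact mul_le_mul_of_nonneg_left ht (norm_nonneg _)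

lemma pow_isBigO_one {ℓ : ℝ → ℂ} {l : Filter ℝ} (hℓ : ℓ =O[l] fun _ => (1 : ℝ)) (p : ℕ) :
    (fun t => ℓ t ^ p) =O[l] fun _ => (1 : ℝ) := by
  simpa using hℓ.pow p

/-- If `f` vanishes to first order at `0` and `ℓ` is a continuous logarithm of `f`, then
`ℓ - log t` is a bounded function, so `f ^ α log ^ p f` grows like `t ^ Re α |log t| ^ p`. -/
lemma isTame_exp_mul_pow {ℓ f : ℝ → ℂ} (hℓ : ContinuousOn ℓ (Ioo 0 1))
    (hexp : ∀ t ∈ Ioo (0 : ℝ) 1, Complex.exp (ℓ t) = f t) {c : ℂ} (hc : c ≠ 0)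
    (hf : Tendsto (fun t : ℝ => f t / t) (𝓝[>] 0) (𝓝 c)) {α : ℂ} (hα : -1 < α.re) (p : ℕ) :
    IsTame fun t => Complex.exp (α * ℓ t) * ℓ t ^ p := by
  let m : ℝ → ℂ := fun t => ℓ t - (Real.log t : ℂ)
  have hm : m =O[𝓝[>] 0] fun _ => (1 : ℝ) := by
    refine isBigO_one_of_exp_eq (f := fun t => f t / t) ?_ ?_ hc hf
    · refine hℓ.sub (Complex.continuous_ofReal.comp_continuousOn ?_)
      exact Real.continuousOn_log.mono fun t ht => ht.1.ne'
    · intro t ht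
      rw [Complex.exp_sub, hexp t ht, ← Complex.ofReal_exp, Real.exp_log ht.1]
  obtain ⟨ε, hε, hεα⟩ : ∃ ε > 0, -α.re + ε < 1 := ⟨(1 + α.re) / 2, by linarith, by linarith⟩
  have hlog : (fun t : ℝ => (Real.log t : ℂ)) =O[𝓝[>] 0] fun t : ℝ => t ^ (-(ε / (p + 1))) := by
    refine IsBigO.trans ?_ (isLittleO_log_rpow_nhdsGT_zero (r := -(ε / (p + 1)))
      (by rw [neg_lt_zero]; positivity)).isBigO
    exact IsBigO.of_bound 1 (Eventually.of_forall fun t => by rw [Complex.norm_real, one_mul])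
  have hone : (fun _ : ℝ => (1 : ℝ)) =O[𝓝[>] 0] fun t : ℝ => t ^ (-(ε / (p + 1))) := by
    have := rpow_neg_isBigO_rpow_neg (a := 0) (b := ε / (p + 1)) (by positivity)
    simpa using this
  have hℓO : (fun t => ℓ t ^ p) =O[𝓝[>] 0] fun t : ℝ => t ^ (-ε) := by
    have h1 : ℓ =O[𝓝[>] 0] fun t : ℝ => t ^ (-(ε / (p + 1))) := by
      refine ((hm.trans hone).add hlog).congr_left fun t => ?_
      simp [m]
    refine ((h1.pow p).congr' EventuallyEq.rfl
      (g₂ := fun t : ℝ => t ^ (-(ε / (p + 1) * p))) ?_).trans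
      (rpow_neg_isBigO_rpow_neg ?_)
    · filter_upwards [self_mem_nhdsWithin] with t ht
      rw [← Real.rpow_natCast, ← Real.rpow_mul (le_of_lt ht), neg_mul]
    · rw [div_mul_eq_mul_div, div_le_iff₀ (by positivity)]
      nlinarith
  refine ⟨-α.re + ε, hεα, ?_⟩
  have hexpO : (fun t => Complex.exp (α * ℓ t)) =O[𝓝[>] 0] fun t : ℝ => t ^ α.re := by
    have h1 : (fun t : ℝ => Complex.exp (α * (Real.log t : ℂ))) =O[𝓝[>] 0]
        fun t : ℝ => t ^ α.re := by
      refine IsBigO.of_bound 1 ?_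
      filter_upwards [self_mem_nhdsWithin] with t ht
      have ht' : (0 : ℝ) < t := ht
      rw [Complex.norm_exp, one_mul, Real.norm_of_nonneg (Real.rpow_nonneg ht'.le _),
        Real.rpow_def_of_pos ht']
      simp [mul_comm]
    refine ((exp_mul_isBigO_one hm α).mul h1).congr (fun t => ?_) fun t => one_mul _
    rw [← Complex.exp_add, ← mul_add]
    simp [m]
  refine (hexpO.mul hℓO).congr' EventuallyEq.rfl ?_
  filter_upwards [self_mem_nhdsWithin] with t ht
  rw [← Real.rpow_add ht]
  congr 1
  ring

/-- One term `φ f^α g^β log^p f log^q g` of a Jacobi type weight near an end point of the curve at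
which `f` vanishes to first order while `g` does not vanish. -/
lemma isTame_jacobi_term {φ ℓ ℓ' f g : ℝ → ℂ} (hℓ : ContinuousOn ℓ (Ioo 0 1))
    (hℓ' : ContinuousOn ℓ' (Ioo 0 1))
    (hf : ∀ t ∈ Ioo (0 : ℝ) 1, Complex.exp (ℓ t) = f t)
    (hg : ∀ t ∈ Ioo (0 : ℝ) 1, Complex.exp (ℓ' t) = g t) {c d e : ℂ} (hc : c ≠ 0) (hd : d ≠ 0)
    (hfc : Tendsto (fun t : ℝ => f t / t) (𝓝[>] 0) (𝓝 c)) (hgd : Tendsto g (𝓝[>] 0) (𝓝 d))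
    (hφ : Tendsto φ (𝓝[>] 0) (𝓝 e)) {α : ℂ} (hα : -1 < α.re) (β : ℂ) (p q : ℕ) :
    IsTame fun t => φ t * Complex.exp (α * ℓ t) * Complex.exp (β * ℓ' t) * ℓ t ^ p * ℓ' t ^ q := by
  have hb := isBigO_one_of_exp_eq hℓ' hg hd hgd
  refine (((((isTame_exp_mul_pow hℓ hf hc hfc hα p).bounded_mul
    (hφ.isBigO_one ℝ)).bounded_mul (exp_mul_isBigO_one hb β)).bounded_mul
      (pow_isBigO_one hb q))).congr fun t _ => ?_
  simp only [Pi.mul_apply]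
  ring

lemma IsTame.exists_integrableOn {f : ℝ → ℂ} (hf : IsTame f) (hc : ContinuousOn f (Ioo 0 1)) :
    ∃ δ > 0, IntegrableOn f (Ioc 0 δ) := by
  obtain ⟨a, ha, hfa⟩ := hf
  have hp : IntegrableAtFilter (fun t : ℝ => t ^ (-a)) (𝓝[>] 0) := by
    refine ⟨Ioc 0 1, Ioc_mem_nhdsGT one_pos, ?_⟩
    rw [← intervalIntegrable_iff_integrableOn_Ioc_of_le zero_le_one]
    exact intervalIntegral.intervalIntegrable_rpow' (by linarith)
  have hm : StronglyMeasurableAtFilter f (𝓝[>] 0) :=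
    ⟨Ioo 0 1, Ioo_mem_nhdsGT one_pos, hc.aestronglyMeasurable measurableSet_Ioo⟩
  obtain ⟨s, hs, hi⟩ := hfa.integrableAtFilter hm hp
  obtain ⟨δ, hδ, hsub⟩ := mem_nhdsGT_iff_exists_Ioc_subset.1 hs
  exact ⟨δ, hδ, hi.mono_set hsub⟩

lemma intervalIntegrable_of_isTame {f : ℝ → ℂ} (hc : ContinuousOn f (Ioo 0 1)) (h0 : IsTame f)
    (h1 : IsTame fun t => f (1 - t)) : IntervalIntegrable f volume 0 1 := by
  have hc' : ContinuousOn (fun t => f (1 - t)) (Ioo 0 1) :=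
    hc.comp (continuousOn_const.sub continuousOn_id) fun t ht =>
      ⟨by simpa using ht.2, by simpa using ht.1⟩
  obtain ⟨δ, hδ, hi⟩ := h0.exists_integrableOn hc
  obtain ⟨δ', hδ', hi'⟩ := h1.exists_integrableOn hc'
  obtain ⟨r, hr, hr1, hrδ, hrδ'⟩ : ∃ r > 0, r < 1 ∧ r ≤ δ ∧ r ≤ δ' :=
    ⟨min (1 / 2) (min δ δ'), by positivity, (min_le_left _ _).trans_lt (by norm_num),
      (min_le_right _ _).trans (min_le_left _ _), (min_le_right _ _).trans (min_le_right _ _)⟩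
  have i1 : IntervalIntegrable f volume 0 r := by
    rw [intervalIntegrable_iff_integrableOn_Ioc_of_le hr.le]
    exact hi.mono_set (Ioc_subset_Ioc_right hrδ)
  have i2 : IntervalIntegrable (fun t => f (1 - t)) volume 0 r := by
    rw [intervalIntegrable_iff_integrableOn_Ioc_of_le hr.le]
    exact hi'.mono_set (Ioc_subset_Ioc_right hrδ')
  have i3 : IntervalIntegrable f volume (1 - r) 1 := by
    have := i2.comp_sub_left 1
    simp only [sub_sub_cancel, sub_zero] at this
    exact this.symm
  have i4 : IntervalIntegrable f volume r (1 - r) := by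
    refine ContinuousOn.intervalIntegrable (hc.mono ?_)
    intro t ht
    rw [Set.mem_uIcc] at ht
    rcases ht with ht | ht <;> exact ⟨by linarith, by linarith⟩
  exact (i1.trans i4).trans i3

/-! ### The arc -/

section Arc

variable {γ : ℝ → ℂ}

lemma IsArc.continuousOn (hγ : IsArc γ) : ContinuousOn γ unitI := hγ.smooth.continuousOn

lemma IsArc.continuousOn_vel (hγ : IsArc γ) : ContinuousOn (vel γ) unitI :=
  hγ.smooth.continuousOn_derivWithin (uniqueDiffOn_Icc zero_lt_one) le_rfl

lemma IsArc.hasDerivWithinAt (hγ : IsArc γ) {t : ℝ} (ht : t ∈ unitI) :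
    HasDerivWithinAt γ (vel γ t) unitI t :=
  ((hγ.smooth.differentiableOn one_ne_zero) t ht).hasDerivWithinAt

lemma IsArc.hasDerivAt (hγ : IsArc γ) {t : ℝ} (ht : t ∈ Ioo (0 : ℝ) 1) :
    HasDerivAt γ (vel γ t) t :=
  (hγ.hasDerivWithinAt (Ioo_subset_Icc_self ht)).hasDerivAt (Icc_mem_nhds ht.1 ht.2)

lemma IsArc.tendsto_div_zero (hγ : IsArc γ) :
    Tendsto (fun t : ℝ => γ t / t) (𝓝[>] 0) (𝓝 (vel γ 0)) := by
  have hmem : unitI ∈ 𝓝[>] (0 : ℝ) :=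
    mem_of_superset (Ioc_mem_nhdsGT (zero_lt_one' ℝ)) Ioc_subset_Icc_self
  have h : HasDerivWithinAt γ (vel γ 0) (Ioi 0) 0 :=
    (hγ.hasDerivWithinAt (left_mem_Icc.2 zero_le_one)).mono_of_mem_nhdsWithin hmem
  rw [hasDerivWithinAt_iff_tendsto_slope' (by simp)] at h
  refine h.congr fun t => ?_
  rw [slope_def_module, hγ.start, sub_zero, sub_zero, Complex.real_smul, Complex.ofReal_inv,
    div_eq_inv_mul]

/-- The reversed curve `t ↦ 1 - γ (1 - t)` leaves `0` with the nonzero velocity `γ'(1)`. -/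
lemma IsArc.tendsto_div_one (hγ : IsArc γ) :
    Tendsto (fun t : ℝ => (1 - γ (1 - t)) / t) (𝓝[>] 0) (𝓝 (vel γ 1)) := by
  have hmem : unitI ∈ 𝓝[<] (1 : ℝ) :=
    mem_of_superset (Ico_mem_nhdsLT (zero_lt_one' ℝ)) Ico_subset_Icc_self
  have h : HasDerivWithinAt γ (vel γ 1) (Iio 1) 1 :=
    (hγ.hasDerivWithinAt (right_mem_Icc.2 zero_le_one)).mono_of_mem_nhdsWithin hmem
  rw [hasDerivWithinAt_iff_tendsto_slope' (by simp)] at h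
  have hm : Tendsto (fun t : ℝ => 1 - t) (𝓝[>] 0) (𝓝[<] 1) := by
    refine tendsto_nhdsWithin_iff.2 ⟨?_, ?_⟩
    · have : ContinuousAt (fun t : ℝ => 1 - t) 0 := by fun_prop
      simpa [ContinuousAt] using this.tendsto.mono_left (nhdsWithin_le_nhds (s := Ioi 0))
    · filter_upwards [self_mem_nhdsWithin] with t ht
      simpa using ht
  refine (h.comp hm).congr' ?_
  filter_upwards [self_mem_nhdsWithin] with t ht
  have ht' : (t : ℂ) ≠ 0 := by exact_mod_cast (ne_of_gt ht)
  rw [Function.comp_apply, slope_def_module, hγ.finish, Complex.real_smul, Complex.ofReal_inv]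
  push_cast
  rw [show (1 - (t : ℂ) - 1) = -t by ring, inv_neg, div_eq_inv_mul]
  ring

lemma IsArc.tendsto_zero (hγ : IsArc γ) : Tendsto γ (𝓝[>] 0) (𝓝 0) := by
  have h := hγ.continuousOn 0 (left_mem_Icc.2 zero_le_one)
  rw [ContinuousWithinAt, hγ.start] at h
  exact h.mono_left (nhdsWithin_le_of_mem
    (mem_of_superset (Ioc_mem_nhdsGT one_pos) Ioc_subset_Icc_self))

lemma IsArc.tendsto_one (hγ : IsArc γ) : Tendsto (fun t => γ (1 - t)) (𝓝[>] 0) (𝓝 1) := by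
  have h := hγ.continuousOn 1 (right_mem_Icc.2 zero_le_one)
  rw [ContinuousWithinAt, hγ.finish] at h
  refine h.comp (tendsto_nhdsWithin_iff.2 ⟨?_, ?_⟩)
  · have : ContinuousAt (fun t : ℝ => 1 - t) 0 := by fun_prop
    simpa [ContinuousAt] using this.tendsto.mono_left (nhdsWithin_le_nhds (s := Ioi 0))
  · filter_upwards [Ioc_mem_nhdsGT one_pos] with t ht
    exact ⟨by linarith [ht.2], by linarith [ht.1]⟩

end Arc

/-! ### Consequences for the weight -/

section Weight

variable {N : ℕ} {γ : ℝ → ℂ} {W : ℂ → Matrix (Fin N) (Fin N) ℂ}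

lemma IsJacobiType.differentiableAt (hγ : IsArc γ) (hW : IsJacobiType γ W) (j k : Fin N) {t : ℝ}
    (ht : t ∈ Ioo (0 : ℝ) 1) : DifferentiableAt ℝ (fun s => W (γ s) j k) t := by
  obtain ⟨ℓ₀, ℓ₁, hc₀, hc₁, hexp, hent⟩ := hW
  obtain ⟨r, φ, α, β, p, q, hφ, hsum⟩ := hent j k
  have hmem : Ioo (0 : ℝ) 1 ∈ 𝓝 t := Ioo_mem_nhds ht.1 ht.2
  have hγd := (hγ.hasDerivAt ht).differentiableAt
  have hd₀ : DifferentiableAt ℝ ℓ₀ t := differentiableAt_of_exp_eq (hc₀.continuousAt hmem)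
    (eventually_of_mem hmem fun s hs => (hexp s hs).1) hγd
  have hd₁ : DifferentiableAt ℝ ℓ₁ t := differentiableAt_of_exp_eq (hc₁.continuousAt hmem)
    (eventually_of_mem hmem fun s hs => (hexp s hs).2) (hγd.const_sub 1)
  refine DifferentiableAt.congr_of_eventuallyEq ?_ (eventually_of_mem hmem hsum)
  refine DifferentiableAt.fun_sum fun m _ => ?_
  have hφd : DifferentiableAt ℝ (fun s => φ m (γ s)) t :=
    (((hφ m).1 (γ t)).restrictScalars ℝ).comp t hγd
  exact (((hφd.mul (hd₀.const_mul _).cexp).mul (hd₁.const_mul _).cexp).mul (hd₀.pow _)).mul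
    (hd₁.pow _)

lemma IsJacobiType.isTame_zero (hγ : IsArc γ) (hW : IsJacobiType γ W) (j k : Fin N) :
    IsTame fun t => W (γ t) j k := by
  obtain ⟨ℓ₀, ℓ₁, hc₀, hc₁, hexp, hent⟩ := hW
  obtain ⟨r, φ, α, β, p, q, hφ, hsum⟩ := hent j k
  refine IsTame.congr (f := ∑ m, fun t => φ m (γ t) * Complex.exp (α m * ℓ₀ t) *
    Complex.exp (β m * ℓ₁ t) * ℓ₀ t ^ p m * ℓ₁ t ^ q m) ?_ fun t ht => ?_
  · refine Finset.sum_induction _ IsTame (fun _ _ => IsTame.add) JacobiRH.isTame_zero fun m _ => ?_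
    refine isTame_jacobi_term hc₀ hc₁ (fun t ht => (hexp t ht).1) (fun t ht => (hexp t ht).2)
      (hγ.vel_ne_zero 0 (left_mem_Icc.2 zero_le_one)) (one_ne_zero) hγ.tendsto_div_zero
      (by simpa using hγ.tendsto_zero.const_sub 1)
      (((hφ m).1.continuous.tendsto 0).comp hγ.tendsto_zero) (hφ m).2.2.1 _ _ _
  · rw [hsum t ht, Finset.sum_apply]

lemma IsJacobiType.isTame_one (hγ : IsArc γ) (hW : IsJacobiType γ W) (j k : Fin N) :
    IsTame fun t => W (γ (1 - t)) j k := by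
  obtain ⟨ℓ₀, ℓ₁, hc₀, hc₁, hexp, hent⟩ := hW
  obtain ⟨r, φ, α, β, p, q, hφ, hsum⟩ := hent j k
  have hmaps : ∀ t ∈ Ioo (0 : ℝ) 1, 1 - t ∈ Ioo (0 : ℝ) 1 := fun t ht =>
    ⟨by linarith [ht.2], by linarith [ht.1]⟩
  have hrev : ContinuousOn (fun t : ℝ => 1 - t) (Ioo 0 1) :=
    continuousOn_const.sub continuousOn_id
  refine IsTame.congr (f := ∑ m, fun t => φ m (γ (1 - t)) * Complex.exp (β m * ℓ₁ (1 - t)) *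
    Complex.exp (α m * ℓ₀ (1 - t)) * ℓ₁ (1 - t) ^ q m * ℓ₀ (1 - t) ^ p m) ?_ fun t ht => ?_
  · refine Finset.sum_induction _ IsTame (fun _ _ => IsTame.add) JacobiRH.isTame_zero fun m _ => ?_
    refine isTame_jacobi_term (ℓ := fun t => ℓ₁ (1 - t)) (ℓ' := fun t => ℓ₀ (1 - t))
      (hc₁.comp hrev hmaps) (hc₀.comp hrev hmaps)
      (fun t ht => (hexp _ (hmaps t ht)).2) (fun t ht => (hexp _ (hmaps t ht)).1)
      (hγ.vel_ne_zero 1 (right_mem_Icc.2 zero_le_one)) (one_ne_zero) hγ.tendsto_div_one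
      hγ.tendsto_one (((hφ m).1.continuous.tendsto 1).comp hγ.tendsto_one) (hφ m).2.2.2 _ _ _
  · rw [hsum _ (hmaps t ht), Finset.sum_apply]
    exact Finset.sum_congr rfl fun m _ => by ring

lemma IsJacobiType.intervalIntegrable (hγ : IsArc γ) (hW : IsJacobiType γ W) (j k : Fin N) :
    IntervalIntegrable (fun t => W (γ t) j k * vel γ t) volume 0 1 := by
  refine IntervalIntegrable.mul_continuousOn ?_ ?_
  · refine intervalIntegrable_of_isTame (fun t ht => ?_) (hW.isTame_zero hγ j k)
      (hW.isTame_one hγ j k)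
    exact (hW.differentiableAt hγ j k ht).continuousAt.continuousWithinAt
  · rw [Set.uIcc_of_le zero_le_one]
    exact hγ.continuousOn_vel

/-- The integrability of the exponents makes `z (1 - z) W` vanish at both ends of the curve. The
values of `W` at the end points themselves are irrelevant since `z (1 - z) = 0` there. -/
lemma IsJacobiType.continuousOn_mul (hγ : IsArc γ) (hW : IsJacobiType γ W) (j k : Fin N) :
    ContinuousOn (fun t => γ t * (1 - γ t) * W (γ t) j k) unitI := by
  have hO : ∀ {f g : ℝ → ℂ} {c d : ℂ}, Tendsto (fun t : ℝ => f t / t) (𝓝[>] 0) (𝓝 c) →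
      Tendsto g (𝓝[>] 0) (𝓝 d) → (fun t => f t * g t) =O[𝓝[>] 0] fun t : ℝ => t := by
    intro f g c d hf hg
    have h1 : f =O[𝓝[>] 0] fun t : ℝ => t := by
      have hid : (fun t : ℝ => (t : ℂ)) =O[𝓝[>] 0] fun t : ℝ => t :=
        IsBigO.of_bound 1 (Eventually.of_forall fun t => by simp)
      refine ((hf.isBigO_one ℝ).mul hid).congr' ?_ (Eventually.of_forall fun t => one_mul _)
      filter_upwards [self_mem_nhdsWithin] with t ht
      have ht' : (t : ℂ) ≠ 0 := by exact_mod_cast (ne_of_gt ht)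
      field_simp
    simpa using h1.mul (hg.isBigO_one ℝ)
  have h0 : Tendsto (fun t => γ t * (1 - γ t) * W (γ t) j k) (𝓝[>] 0) (𝓝 0) :=
    (hW.isTame_zero hγ j k).tendsto_mul (hO hγ.tendsto_div_zero (hγ.tendsto_zero.const_sub 1))
  have h1 : Tendsto (fun t => γ (1 - t) * (1 - γ (1 - t)) * W (γ (1 - t)) j k) (𝓝[>] 0) (𝓝 0) := by
    refine (hW.isTame_one hγ j k).tendsto_mul ?_
    simpa [mul_comm] using hO hγ.tendsto_div_one hγ.tendsto_one
  intro t ht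
  rcases eq_or_lt_of_le ht.1 with rfl | ht0
  · rw [unitI, continuousWithinAt_Icc_iff_Ici zero_lt_one, ← continuousWithinAt_Ioi_iff_Ici]
    simpa [ContinuousWithinAt, hγ.start] using h0
  rcases eq_or_lt_of_le ht.2 with rfl | ht1
  · rw [unitI, continuousWithinAt_Icc_iff_Iic zero_lt_one, ← continuousWithinAt_Iio_iff_Iic]
    have hm : Tendsto (fun t : ℝ => 1 - t) (𝓝[<] 1) (𝓝[>] 0) := by
      refine tendsto_nhdsWithin_iff.2 ⟨?_, ?_⟩
      · have : ContinuousAt (fun t : ℝ => 1 - t) 1 := by fun_prop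
        simpa [ContinuousAt] using this.tendsto.mono_left (nhdsWithin_le_nhds (s := Iio 1))
      · filter_upwards [self_mem_nhdsWithin] with t ht
        simpa using ht
    simpa [ContinuousWithinAt, hγ.finish, Function.comp_def] using h1.comp hm
  · have hd := (hγ.hasDerivAt ⟨ht0, ht1⟩).continuousAt
    exact ((hd.mul (continuousAt_const.sub hd)).mul
      (hW.differentiableAt hγ j k ⟨ht0, ht1⟩).continuousAt).continuousWithinAt

end Weight

/-! ### Matrix biorthogonal polynomials: algebra of moments -/

section Algebra

variable {N : ℕ}

/-- The polynomial `∑_{i<k} z^(k-1-i) μ_i`, i.e. the value on `(s^k - z^k) / (s - z)` of the linear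
functional `s^i ↦ μ_i`. -/
def dividedMoment (μ : ℕ → Matrix (Fin N) (Fin N) ℂ) (k : ℕ) (z : ℂ) : Matrix (Fin N) (Fin N) ℂ :=
  ∑ i ∈ Finset.range k, z ^ (k - 1 - i) • μ i

lemma dividedMoment_add (μ : ℕ → Matrix (Fin N) (Fin N) ℂ) (k l : ℕ) (z : ℂ) :
    dividedMoment μ (k + l) z =
      z ^ l • dividedMoment μ k z + dividedMoment (fun i => μ (k + i)) l z := by
  unfold dividedMoment
  rw [Finset.sum_range_add, Finset.smul_sum]
  congr 1
  · refine Finset.sum_congr rfl fun i hi => ?_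
    rw [smul_smul, ← pow_add]
    have := Finset.mem_range.1 hi
    congr 2
    omega
  · refine Finset.sum_congr rfl fun i hi => ?_
    have := Finset.mem_range.1 hi
    congr 2
    omega

/-- The Christoffel-Darboux type exchange identity behind the biorthogonality relations. -/
lemma smul_dividedMoment_sub (μ : ℕ → Matrix (Fin N) (Fin N) ℂ) (k l : ℕ) (z : ℂ) :
    z ^ l • dividedMoment μ k z - z ^ k • dividedMoment μ l z =
      dividedMoment (fun i => μ (l + i)) k z - dividedMoment (fun i => μ (k + i)) l z := by
  have h1 := dividedMoment_add μ k l z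
  have h2 := dividedMoment_add μ l k z
  rw [add_comm l k, h1] at h2
  rw [sub_eq_sub_iff_add_eq_add, h2, add_comm]

/-- The matrix polynomial `∑_{k≤n} z^k a_k`. -/
def coeffPoly (a : ℕ → Matrix (Fin N) (Fin N) ℂ) (n : ℕ) (z : ℂ) : Matrix (Fin N) (Fin N) ℂ :=
  ∑ k ∈ Finset.range (n + 1), z ^ k • a k

/-- The polynomial of the second kind `∫ (P(s) - P(z)) / (s - z) W(s) ds` attached to
`P = ∑_{k≤n} z^k a_k` and to the moments `μ` of `W`. -/
def secondL (μ a : ℕ → Matrix (Fin N) (Fin N) ℂ) (n : ℕ) (z : ℂ) : Matrix (Fin N) (Fin N) ℂ :=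
  ∑ k ∈ Finset.range (n + 1), a k * dividedMoment μ k z

/-- The polynomial of the second kind `∫ W(s) (P(s) - P(z)) / (s - z) ds` attached to
`P = ∑_{k≤n} z^k b_k` and to the moments `μ` of `W`. -/
def secondR (μ b : ℕ → Matrix (Fin N) (Fin N) ℂ) (n : ℕ) (z : ℂ) : Matrix (Fin N) (Fin N) ℂ :=
  ∑ k ∈ Finset.range (n + 1), dividedMoment μ k z * b k

lemma holomorphicOn_dividedMoment (μ : ℕ → Matrix (Fin N) (Fin N) ℂ) (k : ℕ) :
    HolomorphicOn (dividedMoment μ k) Set.univ :=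
  HolomorphicOn.sum fun _ _ => HolomorphicOn.smul (differentiable_pow _).differentiableOn
    (holomorphicOn_const _ _)

lemma holomorphicOn_coeffPoly (a : ℕ → Matrix (Fin N) (Fin N) ℂ) (n : ℕ) :
    HolomorphicOn (coeffPoly a n) Set.univ :=
  HolomorphicOn.sum fun _ _ => HolomorphicOn.smul (differentiable_pow _).differentiableOn
    (holomorphicOn_const _ _)

lemma holomorphicOn_secondL (μ a : ℕ → Matrix (Fin N) (Fin N) ℂ) (n : ℕ) :
    HolomorphicOn (secondL μ a n) Set.univ :=
  HolomorphicOn.sum fun _ _ => (holomorphicOn_const _ _).mul (holomorphicOn_dividedMoment _ _)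

lemma holomorphicOn_secondR (μ b : ℕ → Matrix (Fin N) (Fin N) ℂ) (n : ℕ) :
    HolomorphicOn (secondR μ b n) Set.univ :=
  HolomorphicOn.sum fun _ _ => (holomorphicOn_dividedMoment _ _).mul (holomorphicOn_const _ _)

lemma secondL_mul_coeffPoly_sub (μ a b : ℕ → Matrix (Fin N) (Fin N) ℂ) (n m : ℕ) (z : ℂ) :
    secondL μ a n z * coeffPoly b m z - coeffPoly a n z * secondR μ b m z =
      secondL (fun i => ∑ l ∈ Finset.range (m + 1), μ (l + i) * b l) a n z -
        secondR (fun i => ∑ k ∈ Finset.range (n + 1), a k * μ (k + i)) b m z := by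
  have hL : secondL (fun i => ∑ l ∈ Finset.range (m + 1), μ (l + i) * b l) a n z =
      ∑ k ∈ Finset.range (n + 1), ∑ l ∈ Finset.range (m + 1),
        a k * dividedMoment (fun i => μ (l + i)) k z * b l := by
    refine Finset.sum_congr rfl fun k _ => ?_
    simp only [dividedMoment, Finset.mul_sum, Finset.sum_mul, Finset.smul_sum]
    rw [Finset.sum_comm]
    simp only [Matrix.mul_smul, Matrix.smul_mul, Matrix.mul_assoc]
  have hR : secondR (fun i => ∑ k ∈ Finset.range (n + 1), a k * μ (k + i)) b m z =
      ∑ k ∈ Finset.range (n + 1), ∑ l ∈ Finset.range (m + 1),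
        a k * dividedMoment (fun i => μ (k + i)) l z * b l := by
    rw [Finset.sum_comm]
    refine Finset.sum_congr rfl fun l _ => ?_
    simp only [dividedMoment, Finset.mul_sum, Finset.sum_mul, Finset.smul_sum]
    rw [Finset.sum_comm]
    simp only [Matrix.mul_smul, Matrix.smul_mul, Matrix.mul_assoc]
  rw [hL, hR, secondL, coeffPoly, coeffPoly, secondR, Finset.sum_mul_sum, Finset.sum_mul_sum,
    ← Finset.sum_sub_distrib, ← Finset.sum_sub_distrib]
  refine Finset.sum_congr rfl fun k _ => ?_
  rw [← Finset.sum_sub_distrib, ← Finset.sum_sub_distrib]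
  refine Finset.sum_congr rfl fun l _ => ?_
  rw [← Matrix.sub_mul, ← Matrix.mul_sub, ← smul_dividedMoment_sub, Matrix.mul_sub, Matrix.sub_mul]
  simp only [Matrix.mul_smul, Matrix.smul_mul, Matrix.mul_assoc]

lemma dividedMoment_eq_zero {r : ℕ → Matrix (Fin N) (Fin N) ℂ} {n : ℕ} (hr : ∀ i < n, r i = 0)
    {k : ℕ} (hk : k ≤ n) (z : ℂ) : dividedMoment r k z = 0 :=
  Finset.sum_eq_zero fun i hi => by
    rw [hr i ((Finset.mem_range.1 hi).trans_le hk), smul_zero]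

lemma dividedMoment_succ_of_eq_zero {r : ℕ → Matrix (Fin N) (Fin N) ℂ} {n : ℕ}
    (hr : ∀ i < n, r i = 0) (z : ℂ) : dividedMoment r (n + 1) z = r n := by
  rw [dividedMoment, Finset.sum_range_succ, Finset.sum_eq_zero fun i hi => by
    rw [hr i (Finset.mem_range.1 hi), smul_zero]]
  simp

lemma secondL_eq_zero {r : ℕ → Matrix (Fin N) (Fin N) ℂ} {n : ℕ} (hr : ∀ i < n, r i = 0)
    (a : ℕ → Matrix (Fin N) (Fin N) ℂ) (z : ℂ) : secondL r a n z = 0 :=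
  Finset.sum_eq_zero fun k hk => by
    rw [dividedMoment_eq_zero hr (Nat.lt_succ_iff.1 (Finset.mem_range.1 hk)), Matrix.mul_zero]

lemma secondR_eq_zero {r : ℕ → Matrix (Fin N) (Fin N) ℂ} {n : ℕ} (hr : ∀ i < n, r i = 0)
    (b : ℕ → Matrix (Fin N) (Fin N) ℂ) (z : ℂ) : secondR r b n z = 0 :=
  Finset.sum_eq_zero fun k hk => by
    rw [dividedMoment_eq_zero hr (Nat.lt_succ_iff.1 (Finset.mem_range.1 hk)), Matrix.zero_mul]

lemma secondL_succ {r : ℕ → Matrix (Fin N) (Fin N) ℂ} {n : ℕ} (hr : ∀ i < n, r i = 0)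
    (a : ℕ → Matrix (Fin N) (Fin N) ℂ) (z : ℂ) : secondL r a (n + 1) z = a (n + 1) * r n := by
  rw [secondL, Finset.sum_range_succ, ← secondL, secondL_eq_zero hr, zero_add,
    dividedMoment_succ_of_eq_zero hr]

lemma secondR_succ {r : ℕ → Matrix (Fin N) (Fin N) ℂ} {n : ℕ} (hr : ∀ i < n, r i = 0)
    (b : ℕ → Matrix (Fin N) (Fin N) ℂ) (z : ℂ) : secondR r b (n + 1) z = r n * b (n + 1) := by
  rw [secondR, Finset.sum_range_succ, ← secondR, secondR_eq_zero hr, zero_add,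
    dividedMoment_succ_of_eq_zero hr]

/-- `a` and `b` are the coefficient sequences of the left and right monic orthogonal polynomials of
degree `n` for the moments `μ`, with normalisation matrix `C`. -/
structure IsOrthoCoeff (μ : ℕ → Matrix (Fin N) (Fin N) ℂ) (n : ℕ)
    (a b : ℕ → Matrix (Fin N) (Fin N) ℂ) (C : Matrix (Fin N) (Fin N) ℂ) : Prop where
  monicL : a n = 1
  monicR : b n = 1
  det_ne_zero : C.det ≠ 0
  orthL : ∀ j ≤ n, ∑ k ∈ Finset.range (n + 1), a k * μ (k + j) = if j = n then C⁻¹ else 0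
  orthR : ∀ j ≤ n, ∑ k ∈ Finset.range (n + 1), μ (k + j) * b k = if j = n then C⁻¹ else 0

section Biorthogonality

variable {μ a b a' b' : ℕ → Matrix (Fin N) (Fin N) ℂ} {C C' : Matrix (Fin N) (Fin N) ℂ} {n : ℕ}

lemma IsOrthoCoeff.orthL_of_lt (h : IsOrthoCoeff μ n a b C) {j : ℕ} (hj : j < n) :
    ∑ k ∈ Finset.range (n + 1), a k * μ (k + j) = 0 := by
  rw [h.orthL j hj.le, if_neg hj.ne]

lemma IsOrthoCoeff.orthR_of_lt (h : IsOrthoCoeff μ n a b C) {j : ℕ} (hj : j < n) :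
    ∑ k ∈ Finset.range (n + 1), μ (k + j) * b k = 0 := by
  rw [h.orthR j hj.le, if_neg hj.ne]

lemma IsOrthoCoeff.wronskian_self (h : IsOrthoCoeff μ n a b C) (z : ℂ) :
    secondL μ a n z * coeffPoly b n z - coeffPoly a n z * secondR μ b n z = 0 := by
  rw [secondL_mul_coeffPoly_sub, secondL_eq_zero fun i hi => h.orthR_of_lt hi,
    secondR_eq_zero fun i hi => h.orthL_of_lt hi, sub_zero]

lemma IsOrthoCoeff.wronskian_succ_left (h : IsOrthoCoeff μ n a b C)
    (h' : IsOrthoCoeff μ (n + 1) a' b' C') (z : ℂ) :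
    secondL μ a' (n + 1) z * coeffPoly b n z - coeffPoly a' (n + 1) z * secondR μ b n z = C⁻¹ := by
  rw [secondL_mul_coeffPoly_sub, secondL_succ fun i hi => h.orthR_of_lt hi,
    secondR_eq_zero fun i hi => h'.orthL_of_lt (hi.trans n.lt_succ_self), sub_zero, h'.monicL,
    Matrix.one_mul, h.orthR n le_rfl, if_pos rfl]

lemma IsOrthoCoeff.wronskian_succ_right (h : IsOrthoCoeff μ n a b C)
    (h' : IsOrthoCoeff μ (n + 1) a' b' C') (z : ℂ) :
    secondL μ a n z * coeffPoly b' (n + 1) z - coeffPoly a n z * secondR μ b' (n + 1) z =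
      -C⁻¹ := by
  rw [secondL_mul_coeffPoly_sub, secondR_succ fun i hi => h.orthL_of_lt hi,
    secondL_eq_zero fun i hi => h'.orthR_of_lt (hi.trans n.lt_succ_self), zero_sub, h'.monicR,
    Matrix.mul_one, h.orthL n le_rfl, if_pos rfl]

end Biorthogonality

/-! ### Existence of the orthogonal polynomials -/

/-- The block Hankel matrix `[μ_{j+k}]_{j,k<n}`. -/
def hankel (μ : ℕ → Matrix (Fin N) (Fin N) ℂ) (n : ℕ) :
    Matrix (Fin n × Fin N) (Fin n × Fin N) ℂ :=
  Matrix.of fun r s => μ ((r.1 : ℕ) + (s.1 : ℕ)) r.2 s.2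

/-- The block at position `(k, l)` of a block matrix. -/
def blockAt {n : ℕ} (G : Matrix (Fin n × Fin N) (Fin n × Fin N) ℂ) (k l : Fin n) :
    Matrix (Fin N) (Fin N) ℂ :=
  Matrix.of fun i j => G (k, i) (l, j)

lemma blockAt_mul {n : ℕ} (G H : Matrix (Fin n × Fin N) (Fin n × Fin N) ℂ) (k l : Fin n) :
    blockAt (G * H) k l = ∑ j, blockAt G k j * blockAt H j l := by
  ext p q
  simp only [blockAt, Matrix.of_apply, Matrix.mul_apply, Matrix.sum_apply, Fintype.sum_prod_type]

lemma blockAt_one {n : ℕ} (k l : Fin n) :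
    blockAt (1 : Matrix (Fin n × Fin N) (Fin n × Fin N) ℂ) k l = if k = l then 1 else 0 := by
  ext p q
  by_cases h : k = l <;> simp [blockAt, Matrix.one_apply, h]

lemma blockAt_hankel (μ : ℕ → Matrix (Fin N) (Fin N) ℂ) {n : ℕ} (k l : Fin n) :
    blockAt (hankel μ n) k l = μ (k + l) := rfl

/-- The last diagonal block of the inverse of the block Hankel matrix is the inverse of a Schur
complement, so it is nonsingular as soon as the Hankel matrix of the next smaller size is. -/
lemma det_blockAt_inv_hankel_ne_zero {μ : ℕ → Matrix (Fin N) (Fin N) ℂ} {n : ℕ}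
    (h₀ : (hankel μ n).det ≠ 0) (h₁ : (hankel μ (n + 1)).det ≠ 0) :
    (blockAt (hankel μ (n + 1))⁻¹ (Fin.last n) (Fin.last n)).det ≠ 0 := by
  intro hdet
  obtain ⟨v, hv, hv0⟩ := Matrix.exists_vecMul_eq_zero_iff.2 hdet
  apply hv
  set G := (hankel μ (n + 1))⁻¹ with hG
  have hGH : G * hankel μ (n + 1) = 1 := Matrix.nonsing_inv_mul _ (isUnit_iff_ne_zero.2 h₁)
  -- `x` is the combination with weights `v` of the last block row of the inverse
  let e : Fin (n + 1) × Fin N → ℂ := fun r => if r.1 = Fin.last n then v r.2 else 0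
  let x := Matrix.vecMul e G
  have hx : Matrix.vecMul x (hankel μ (n + 1)) = e := by
    rw [Matrix.vecMul_vecMul, hGH, Matrix.vecMul_one]
  have hxlast : ∀ q, x (Fin.last n, q) = 0 := by
    intro q
    have := congrFun hv0 q
    simp only [Matrix.vecMul, dotProduct, blockAt, Matrix.of_apply, Pi.zero_apply] at this
    simp only [x, e, Matrix.vecMul, dotProduct, Fintype.sum_prod_type, Fin.sum_univ_castSucc,
      Fin.castSucc_ne_last, if_false, if_true, zero_mul, Finset.sum_const_zero, zero_add, this]
  have hx' : (fun r : Fin n × Fin N => x (r.1.castSucc, r.2)) = 0 := by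
    refine Matrix.eq_zero_of_vecMul_eq_zero h₀ ?_
    funext s
    have := congrFun hx (s.1.castSucc, s.2)
    simpa [Matrix.vecMul, dotProduct, Fintype.sum_prod_type, Fin.sum_univ_castSucc, hxlast, e,
      hankel, Fin.castSucc_ne_last] using this
  have hx0 : x = 0 := by
    funext r
    obtain ⟨k, p⟩ := r
    refine Fin.lastCases (hxlast p) (fun k => ?_) k
    exact congrFun hx' (k, p)
  funext q
  have := congrFun hx (Fin.last n, q)
  rw [hx0, Matrix.zero_vecMul] at this
  simpa [e] using this.symm

/-- The coefficients of `monicPoly c`, the leading one included. -/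
def monicCoeff {n : ℕ} (c : Fin n → Matrix (Fin N) (Fin N) ℂ) (k : ℕ) : Matrix (Fin N) (Fin N) ℂ :=
  if h : k < n then c ⟨k, h⟩ else 1

lemma monicCoeff_self {n : ℕ} (c : Fin n → Matrix (Fin N) (Fin N) ℂ) : monicCoeff c n = 1 :=
  dif_neg (lt_irrefl n)

lemma monicCoeff_val {n : ℕ} (c : Fin n → Matrix (Fin N) (Fin N) ℂ) (k : Fin n) :
    monicCoeff c k = c k := dif_pos k.2

lemma monicPoly_eq_coeffPoly {n : ℕ} (c : Fin n → Matrix (Fin N) (Fin N) ℂ) (z : ℂ) :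
    monicPoly c z = coeffPoly (monicCoeff c) n z := by
  rw [monicPoly, coeffPoly, Finset.sum_range_succ, monicCoeff_self, ← Fin.sum_univ_eq_sum_range
    (fun k => z ^ k • monicCoeff c k), add_comm]
  simp only [monicCoeff_val]

lemma exists_isOrthoCoeff {μ : ℕ → Matrix (Fin N) (Fin N) ℂ} {n : ℕ}
    (h₀ : (hankel μ n).det ≠ 0) (h₁ : (hankel μ (n + 1)).det ≠ 0) :
    ∃ d : OrthData N n, IsOrthoCoeff μ n (monicCoeff d.cL) (monicCoeff d.cR) d.C := by
  set G := (hankel μ (n + 1))⁻¹ with hG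
  have hGH : G * hankel μ (n + 1) = 1 := Matrix.nonsing_inv_mul _ (isUnit_iff_ne_zero.2 h₁)
  have hHG : hankel μ (n + 1) * G = 1 := Matrix.mul_nonsing_inv _ (isUnit_iff_ne_zero.2 h₁)
  set C := blockAt G (Fin.last n) (Fin.last n) with hC
  have hCdet : C.det ≠ 0 := det_blockAt_inv_hankel_ne_zero h₀ h₁
  have hCu : IsUnit C.det := isUnit_iff_ne_zero.2 hCdet
  refine ⟨⟨fun k => C⁻¹ * blockAt G (Fin.last n) k.castSucc,
    fun k => blockAt G k.castSucc (Fin.last n) * C⁻¹, C⟩, monicCoeff_self _, monicCoeff_self _,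
    hCdet, fun j hj => ?_, fun j hj => ?_⟩
  · have hj' : j < n + 1 := Nat.lt_succ_of_le hj
    have h := congrArg (fun X => C⁻¹ * blockAt X (Fin.last n) ⟨j, hj'⟩) hGH
    simp only [blockAt_mul, blockAt_one, blockAt_hankel, Finset.mul_sum] at h
    rw [← Fin.sum_univ_eq_sum_range (fun k => monicCoeff _ k * μ (k + j)), Fin.sum_univ_castSucc]
    rw [Fin.sum_univ_castSucc] at h
    simp only [Fin.val_castSucc, Fin.val_last, monicCoeff_val, monicCoeff_self]
    simp only [Fin.val_castSucc, Fin.val_last, ← Matrix.mul_assoc, ← hC,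
      Matrix.nonsing_inv_mul _ hCu] at h
    rw [h]
    by_cases hjn : j = n
    · subst hjn; simp [Fin.last]
    · rw [if_neg hjn, if_neg, Matrix.mul_zero]
      exact fun h => hjn (Fin.ext_iff.1 h).symm
  · have hj' : j < n + 1 := Nat.lt_succ_of_le hj
    have h := congrArg (fun X => blockAt X ⟨j, hj'⟩ (Fin.last n) * C⁻¹) hHG
    simp only [blockAt_mul, blockAt_one, blockAt_hankel, Finset.sum_mul] at h
    rw [← Fin.sum_univ_eq_sum_range (fun k => μ (k + j) * monicCoeff _ k), Fin.sum_univ_castSucc]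
    rw [Fin.sum_univ_castSucc] at h
    simp only [Fin.val_castSucc, Fin.val_last, monicCoeff_val, monicCoeff_self]
    simp only [Fin.val_castSucc, Fin.val_last, Matrix.mul_assoc, ← hC,
      Matrix.mul_nonsing_inv _ hCu] at h
    simp only [add_comm _ j]
    rw [h]
    by_cases hjn : j = n
    · subst hjn; simp [Fin.last]
    · rw [if_neg hjn, if_neg, Matrix.zero_mul]
      exact fun h => hjn (Fin.ext_iff.1 h)

end Algebra

/-! ### Integrals along the arc and moments -/

section ArcIntegral

variable {N : ℕ} {γ : ℝ → ℂ} {W : ℂ → Matrix (Fin N) (Fin N) ℂ}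

lemma arcIntegral_congr {m n : Type*} {f g : ℝ → Matrix m n ℂ} (h : ∀ t ∈ unitI, f t = g t) :
    arcIntegral γ f = arcIntegral γ g := by
  ext i j
  simp only [arcIntegral, Matrix.of_apply]
  congr 1
  refine intervalIntegral.integral_congr fun t ht => ?_
  rw [Set.uIcc_of_le zero_le_one] at ht
  simp only [h t ht]

/-- Constant matrix factors and finite sums come out of integrals against `W`. -/
lemma arcIntegral_sum_smul_mul
    (hW : ∀ j k, IntervalIntegrable (fun t => W (γ t) j k * vel γ t) volume 0 1)
    {ι : Type*} (s : Finset ι) {g : ι → ℝ → ℂ} (hg : ∀ k ∈ s, ContinuousOn (g k) unitI)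
    (A B : ι → Matrix (Fin N) (Fin N) ℂ) :
    arcIntegral γ (fun t => ∑ k ∈ s, g k t • (A k * W (γ t) * B k)) =
      ∑ k ∈ s, A k * arcIntegral γ (fun t => g k t • W (γ t)) * B k := by
  have hint : ∀ k ∈ s, ∀ a b,
      IntervalIntegrable (fun t => g k t * (W (γ t) a b * vel γ t)) volume 0 1 := fun k hk a b =>
    (hW a b).continuousOn_mul (by rw [Set.uIcc_of_le zero_le_one]; exact hg k hk)
  ext i j
  simp only [arcIntegral, Matrix.of_apply, Matrix.sum_apply, Matrix.smul_apply, Matrix.mul_apply,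
    smul_eq_mul]
  have h1 : ∀ t, (∑ k ∈ s, g k t * ∑ b, (∑ a, A k i a * W (γ t) a b) * B k b j) * vel γ t =
      ∑ k ∈ s, ∑ b, ∑ a, A k i a * (g k t * (W (γ t) a b * vel γ t)) * B k b j := by
    intro t
    rw [Finset.sum_mul]
    refine Finset.sum_congr rfl fun k _ => ?_
    rw [Finset.mul_sum, Finset.sum_mul]
    refine Finset.sum_congr rfl fun b _ => ?_
    rw [Finset.sum_mul, Finset.mul_sum, Finset.sum_mul]
    exact Finset.sum_congr rfl fun a _ => by ring
  have hterm : ∀ k ∈ s, ∀ b a, IntervalIntegrable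
      (fun t => A k i a * (g k t * (W (γ t) a b * vel γ t)) * B k b j) volume 0 1 :=
    fun k hk b a => ((hint k hk a b).const_mul _).mul_const _
  have hterm₂ : ∀ k ∈ s, ∀ b, IntervalIntegrable
      (fun t => ∑ a, A k i a * (g k t * (W (γ t) a b * vel γ t)) * B k b j) volume 0 1 :=
    fun k hk b => by simpa only [Finset.sum_fn] using
      IntervalIntegrable.sum Finset.univ fun a _ => hterm k hk b a
  have hterm₃ : ∀ k ∈ s, IntervalIntegrable
      (fun t => ∑ b, ∑ a, A k i a * (g k t * (W (γ t) a b * vel γ t)) * B k b j) volume 0 1 :=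
    fun k hk => by simpa only [Finset.sum_fn] using
      IntervalIntegrable.sum Finset.univ fun b _ => hterm₂ k hk b
  simp only [h1]
  rw [intervalIntegral.integral_finsetSum hterm₃, Finset.mul_sum]
  refine Finset.sum_congr rfl fun k hk => ?_
  rw [intervalIntegral.integral_finsetSum fun b _ => hterm₂ k hk b, Finset.mul_sum]
  refine Finset.sum_congr rfl fun b _ => ?_
  rw [intervalIntegral.integral_finsetSum fun a _ => hterm k hk b a, Finset.mul_sum,
    Finset.sum_mul]
  refine Finset.sum_congr rfl fun a _ => ?_
  rw [intervalIntegral.integral_mul_const, intervalIntegral.integral_const_mul]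
  simp only [mul_assoc]
  ring

lemma arcIntegral_smul_coeffPoly_mul (hγ : ContinuousOn γ unitI)
    (hW : ∀ j k, IntervalIntegrable (fun t => W (γ t) j k * vel γ t) volume 0 1)
    {g : ℝ → ℂ} (hg : ContinuousOn g unitI) (a : ℕ → Matrix (Fin N) (Fin N) ℂ) (n : ℕ) :
    arcIntegral γ (fun t => g t • (coeffPoly a n (γ t) * W (γ t))) =
      ∑ k ∈ Finset.range (n + 1), a k * arcIntegral γ (fun t => (g t * γ t ^ k) • W (γ t)) := by
  have h := arcIntegral_sum_smul_mul hW (Finset.range (n + 1)) (g := fun k t => g t * γ t ^ k)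
    (fun k _ => hg.mul (hγ.pow k)) a fun _ => 1
  simp only [Matrix.mul_one] at h
  rw [← h]
  refine arcIntegral_congr fun t _ => ?_
  simp only [coeffPoly, Finset.sum_mul, Finset.smul_sum, Matrix.smul_mul, smul_smul]

lemma arcIntegral_smul_mul_coeffPoly (hγ : ContinuousOn γ unitI)
    (hW : ∀ j k, IntervalIntegrable (fun t => W (γ t) j k * vel γ t) volume 0 1)
    {g : ℝ → ℂ} (hg : ContinuousOn g unitI) (b : ℕ → Matrix (Fin N) (Fin N) ℂ) (n : ℕ) :
    arcIntegral γ (fun t => g t • (W (γ t) * coeffPoly b n (γ t))) =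
      ∑ k ∈ Finset.range (n + 1), arcIntegral γ (fun t => (g t * γ t ^ k) • W (γ t)) * b k := by
  have h := arcIntegral_sum_smul_mul hW (Finset.range (n + 1)) (g := fun k t => g t * γ t ^ k)
    (fun k _ => hg.mul (hγ.pow k)) (fun _ => 1) b
  simp only [Matrix.one_mul] at h
  rw [← h]
  refine arcIntegral_congr fun t _ => ?_
  simp only [coeffPoly, Finset.mul_sum, Finset.smul_sum, Matrix.mul_smul, smul_smul]

lemma isOrthogonal_iff_isOrthoCoeff (hγ : ContinuousOn γ unitI)
    (hW : ∀ j k, IntervalIntegrable (fun t => W (γ t) j k * vel γ t) volume 0 1)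
    {n : ℕ} (d : OrthData N n) :
    IsOrthogonal γ W d ↔
      IsOrthoCoeff (moment γ W) n (monicCoeff d.cL) (monicCoeff d.cR) d.C := by
  have hL : ∀ j, arcIntegral γ (fun t => γ t ^ j • (monicPoly d.cL (γ t) * W (γ t))) =
      ∑ k ∈ Finset.range (n + 1), monicCoeff d.cL k * moment γ W (k + j) := by
    intro j
    simp only [monicPoly_eq_coeffPoly, moment]
    rw [arcIntegral_smul_coeffPoly_mul hγ hW (g := fun t => γ t ^ j) (hγ.pow j)]
    simp only [← pow_add, add_comm j]
  have hR : ∀ j, arcIntegral γ (fun t => γ t ^ j • (W (γ t) * monicPoly d.cR (γ t))) =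
      ∑ k ∈ Finset.range (n + 1), moment γ W (k + j) * monicCoeff d.cR k := by
    intro j
    simp only [monicPoly_eq_coeffPoly, moment]
    rw [arcIntegral_smul_mul_coeffPoly hγ hW (g := fun t => γ t ^ j) (hγ.pow j)]
    simp only [← pow_add, add_comm j]
  simp only [IsOrthogonal, hL, hR]
  exact ⟨fun h => ⟨monicCoeff_self _, monicCoeff_self _, h.1, fun j hj => (h.2 j hj).1,
    fun j hj => (h.2 j hj).2⟩, fun h => ⟨h.det_ne_zero, fun j hj => ⟨h.orthL j hj, h.orthR j hj⟩⟩⟩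

/-- For a regular weight the chosen solution of the orthogonality conditions is a genuine one. -/
lemma isOrthoCoeff_orthData (hγ : ContinuousOn γ unitI)
    (hW : ∀ j k, IntervalIntegrable (fun t => W (γ t) j k * vel γ t) volume 0 1)
    (hreg : IsRegularWeight γ W) (n : ℕ) :
    IsOrthoCoeff (moment γ W) n (monicCoeff (orthData γ W n).cL) (monicCoeff (orthData γ W n).cR)
      (Cmat γ W n) := by
  have hH : ∀ n, (hankel (moment γ W) n).det ≠ 0 := by
    rintro (_ | n)
    · rw [Matrix.det_isEmpty]; exact one_ne_zero
    · exact hreg n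
  obtain ⟨d, hd⟩ := exists_isOrthoCoeff (hH n) (hH (n + 1))
  rw [Cmat, ← isOrthogonal_iff_isOrthoCoeff hγ hW]
  exact Classical.epsilon_spec ⟨d, (isOrthogonal_iff_isOrthoCoeff hγ hW d).2 hd⟩

/-- The Cauchy transform of the weight. -/
noncomputable def cauchyTransform (γ : ℝ → ℂ) (W : ℂ → Matrix (Fin N) (Fin N) ℂ) (z : ℂ) :
    Matrix (Fin N) (Fin N) ℂ :=
  arcIntegral γ fun t => (γ t - z)⁻¹ • W (γ t)

lemma arcIntegral_inv_sub_mul_pow (hγ : ContinuousOn γ unitI)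
    (hW : ∀ j k, IntervalIntegrable (fun t => W (γ t) j k * vel γ t) volume 0 1)
    {z : ℂ} (hz : z ∉ γ '' unitI) (k : ℕ) :
    arcIntegral γ (fun t => ((γ t - z)⁻¹ * γ t ^ k) • W (γ t)) =
      z ^ k • cauchyTransform γ W z + dividedMoment (moment γ W) k z := by
  have hne : ∀ t ∈ unitI, γ t - z ≠ 0 := fun t ht h => hz ⟨t, ht, sub_eq_zero.1 h⟩
  have hinv : ContinuousOn (fun t => (γ t - z)⁻¹) unitI :=
    (hγ.sub continuousOn_const).inv₀ hne
  have h := arcIntegral_sum_smul_mul hW (Finset.range (k + 1))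
    (g := fun i t => if i < k then γ t ^ i else (γ t - z)⁻¹) (fun i _ => by
      by_cases hi : i < k
      · simp only [hi, if_true]; exact hγ.pow i
      · simp only [hi, if_false]; exact hinv)
    (fun i => if i < k then z ^ (k - 1 - i) • 1 else z ^ k • 1) fun _ => 1
  have hlt : ∀ i ∈ Finset.range k, i < k := fun i hi => Finset.mem_range.1 hi
  simp only [Finset.sum_range_succ, lt_irrefl, if_false, Matrix.mul_one] at h
  rw [Finset.sum_congr rfl fun i hi => by rw [if_pos (hlt i hi)]] at h
  simp only [Matrix.smul_mul, Matrix.one_mul] at h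
  rw [add_comm, dividedMoment, cauchyTransform]
  simp only [moment]
  have h2 : ∀ i ∈ Finset.range k, z ^ (k - 1 - i) • arcIntegral γ (fun t => γ t ^ i • W (γ t)) =
      z ^ (k - 1 - i) • arcIntegral γ
        (fun t => (if i < k then γ t ^ i else (γ t - z)⁻¹) • W (γ t)) := fun i hi => by
    simp only [hlt i hi, if_true]
  rw [Finset.sum_congr rfl h2, ← h]
  refine arcIntegral_congr fun t ht => ?_
  rw [Finset.sum_congr rfl fun i hi => by rw [if_pos (hlt i hi), if_pos (hlt i hi)]]
  simp only [Matrix.smul_mul, Matrix.one_mul, smul_smul]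
  rw [← Finset.sum_smul, ← add_smul]
  congr 1
  have hgeom := Commute.geom_sum₂_mul (Commute.all (γ t) z) k
  have hne' := hne t ht
  field_simp
  linear_combination -hgeom

/-- The second kind function is `P c + E` with `c` the Cauchy transform of the weight and `E` the
polynomial of the second kind. -/
lemma QL_eq (hγ : ContinuousOn γ unitI)
    (hW : ∀ j k, IntervalIntegrable (fun t => W (γ t) j k * vel γ t) volume 0 1)
    {z : ℂ} (hz : z ∉ γ '' unitI) (n : ℕ) :
    QL γ W n z = PL γ W n z * cauchyTransform γ W z +
      secondL (moment γ W) (monicCoeff (orthData γ W n).cL) n z := by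
  have hne : ∀ t ∈ unitI, γ t - z ≠ 0 := fun t ht h => hz ⟨t, ht, sub_eq_zero.1 h⟩
  simp only [QL, PL, monicPoly_eq_coeffPoly]
  rw [arcIntegral_smul_coeffPoly_mul hγ hW (g := fun t => (γ t - z)⁻¹)
    ((hγ.sub continuousOn_const).inv₀ hne)]
  simp only [arcIntegral_inv_sub_mul_pow hγ hW hz, secondL, coeffPoly, Finset.sum_mul,
    ← Finset.sum_add_distrib, Matrix.mul_add, Matrix.mul_smul, Matrix.smul_mul]

lemma QR_eq (hγ : ContinuousOn γ unitI)
    (hW : ∀ j k, IntervalIntegrable (fun t => W (γ t) j k * vel γ t) volume 0 1)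
    {z : ℂ} (hz : z ∉ γ '' unitI) (n : ℕ) :
    QR γ W n z = cauchyTransform γ W z * PR γ W n z +
      secondR (moment γ W) (monicCoeff (orthData γ W n).cR) n z := by
  have hne : ∀ t ∈ unitI, γ t - z ≠ 0 := fun t ht h => hz ⟨t, ht, sub_eq_zero.1 h⟩
  simp only [QR, PR, monicPoly_eq_coeffPoly]
  rw [arcIntegral_smul_mul_coeffPoly hγ hW (g := fun t => (γ t - z)⁻¹)
    ((hγ.sub continuousOn_const).inv₀ hne)]
  simp only [arcIntegral_inv_sub_mul_pow hγ hW hz, secondR, coeffPoly, Finset.mul_sum,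
    ← Finset.sum_add_distrib, Matrix.add_mul, Matrix.mul_smul, Matrix.smul_mul]

end ArcIntegral

/-! ### The Pearson equation for the Cauchy transform -/

section Pearson

variable {N : ℕ} {γ : ℝ → ℂ} {W : ℂ → Matrix (Fin N) (Fin N) ℂ}

/-- Up to an entire function, an entire factor comes out of a Cauchy integral. -/
lemma integral_inv_sub_mul_entire (hγ : ContinuousOn γ unitI) {w : ℝ → ℂ}
    (hw : IntervalIntegrable w volume 0 1) {f : ℂ → ℂ} (hf : Differentiable ℂ f) {z : ℂ}
    (hz : z ∉ γ '' unitI) :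
    ∫ t in (0 : ℝ)..1, (γ t - z)⁻¹ * (f (γ t) * w t) =
      f z * (∫ t in (0 : ℝ)..1, (γ t - z)⁻¹ * w t) +
        ∫ t in (0 : ℝ)..1, dslope f (γ t) z * w t := by
  have hne : ∀ t ∈ unitI, γ t - z ≠ 0 := fun t ht h => hz ⟨t, ht, sub_eq_zero.1 h⟩
  have hds : ContinuousOn (fun t => dslope f (γ t) z) unitI := by
    simp only [dslope_comm f _ z]
    refine (Differentiable.continuous (𝕜 := ℂ) ?_).comp_continuousOn hγ
    rw [← differentiableOn_univ] at hf ⊢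
    exact (Complex.differentiableOn_dslope univ_mem).2 hf
  have hinv : ContinuousOn (fun t => (γ t - z)⁻¹) unitI := (hγ.sub continuousOn_const).inv₀ hne
  rw [unitI, ← Set.uIcc_of_le zero_le_one] at hds hinv
  rw [← intervalIntegral.integral_const_mul,
    ← intervalIntegral.integral_add ((hw.continuousOn_mul hinv).const_mul _)
      (hw.continuousOn_mul hds)]
  refine intervalIntegral.integral_congr fun t ht => ?_
  rw [Set.uIcc_of_le zero_le_one] at ht
  have hne' := hne t ht
  have h := sub_smul_dslope f z (γ t)
  rw [smul_eq_mul, dslope_comm] at h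
  field_simp
  linear_combination (-w t) * h

/-- Integration by parts: the boundary terms vanish because `z (1 - z) W` does so at both ends of
the curve, and `s (1 - s) = z (1 - z) + (s - z) (1 - 2 s) + (s - z) ^ 2`. -/
lemma integral_pearson (hγ : IsArc γ) (hW : IsJacobiType γ W)
    {hL hR : ℂ → Matrix (Fin N) (Fin N) ℂ} (hhL : HolomorphicOn hL Set.univ)
    (hhR : HolomorphicOn hR Set.univ) (hP : PearsonEq γ W hL hR) {z : ℂ} (hz : z ∉ γ '' unitI)
    (j k : Fin N) :
    z * (1 - z) * ∫ t in (0 : ℝ)..1, ((γ t - z) ^ 2)⁻¹ * (W (γ t) j k * vel γ t) =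
      ∑ a, (∫ t in (0 : ℝ)..1, (γ t - z)⁻¹ * (hL (γ t) j a * (W (γ t) a k * vel γ t))) +
      ∑ a, (∫ t in (0 : ℝ)..1, (γ t - z)⁻¹ * (hR (γ t) a k * (W (γ t) j a * vel γ t))) -
      ∫ t in (0 : ℝ)..1, W (γ t) j k * vel γ t := by
  have hne : ∀ t ∈ unitI, γ t - z ≠ 0 := fun t ht h => hz ⟨t, ht, sub_eq_zero.1 h⟩
  have hinv : ContinuousOn (fun t => (γ t - z)⁻¹) unitI :=
    (hγ.continuousOn.sub continuousOn_const).inv₀ hne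
  have hw := hW.intervalIntegrable hγ
  have hu : Set.uIcc (0 : ℝ) 1 = unitI := Set.uIcc_of_le zero_le_one
  have i1 : IntervalIntegrable (fun t => ((γ t - z) ^ 2)⁻¹ * (W (γ t) j k * vel γ t))
      volume 0 1 := by
    refine (hw j k).continuousOn_mul ?_
    rw [hu]
    exact ((hγ.continuousOn.sub continuousOn_const).pow 2).inv₀ fun t ht =>
      pow_ne_zero 2 (hne t ht)
  have i2 : ∀ f : ℂ → ℂ, DifferentiableOn ℂ f Set.univ → ∀ a b, IntervalIntegrable
      (fun t => (γ t - z)⁻¹ * (f (γ t) * (W (γ t) a b * vel γ t))) volume 0 1 := by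
    intro f hf a b
    refine ((hw a b).continuousOn_mul (g := fun t => f (γ t)) ?_).continuousOn_mul ?_
    · rw [hu]
      exact (differentiableOn_univ.1 hf).continuous.comp_continuousOn hγ.continuousOn
    · rwa [hu]
  have i3 : IntervalIntegrable
      (fun t => ∑ a, (γ t - z)⁻¹ * (hL (γ t) j a * (W (γ t) a k * vel γ t))) volume 0 1 := by
    simpa only [Finset.sum_fn] using
      IntervalIntegrable.sum Finset.univ fun a _ => i2 _ (hhL j a) a k
  have i4 : IntervalIntegrable
      (fun t => ∑ a, (γ t - z)⁻¹ * (hR (γ t) a k * (W (γ t) j a * vel γ t))) volume 0 1 := by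
    simpa only [Finset.sum_fn] using
      IntervalIntegrable.sum Finset.univ fun a _ => i2 _ (hhR a k) j a
  have hderiv : ∀ t ∈ Ioo (0 : ℝ) 1,
      HasDerivAt (fun s => γ s * (1 - γ s) * W (γ s) j k * (γ s - z)⁻¹)
        (∑ a, (γ t - z)⁻¹ * (hL (γ t) j a * (W (γ t) a k * vel γ t)) +
          ∑ a, (γ t - z)⁻¹ * (hR (γ t) a k * (W (γ t) j a * vel γ t)) -
          W (γ t) j k * vel γ t -
          z * (1 - z) * (((γ t - z) ^ 2)⁻¹ * (W (γ t) j k * vel γ t))) t := by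
    intro t ht
    have htI := Ioo_subset_Icc_self ht
    have hne' := hne t htI
    have hg := hγ.hasDerivAt ht
    have hd := (hW.differentiableAt hγ j k ht).hasDerivAt
    have hv := hγ.vel_ne_zero t htI
    have hpe := congrFun (congrFun (hP t ht) j) k
    simp only [derivAlong, Matrix.smul_apply, Matrix.of_apply, Matrix.add_apply, Matrix.mul_apply,
      smul_eq_mul] at hpe
    have hpe' : γ t * (1 - γ t) * deriv (fun s => W (γ s) j k) t =
        vel γ t * (∑ a, hL (γ t) j a * W (γ t) a k + ∑ a, W (γ t) j a * hR (γ t) a k) := by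
      rw [← hpe]
      field_simp
    have hsumL : ∑ a, (γ t - z)⁻¹ * (hL (γ t) j a * (W (γ t) a k * vel γ t)) =
        (γ t - z)⁻¹ * (vel γ t * ∑ a, hL (γ t) j a * W (γ t) a k) := by
      simp only [Finset.mul_sum]
      exact Finset.sum_congr rfl fun a _ => by ring
    have hsumR : ∑ a, (γ t - z)⁻¹ * (hR (γ t) a k * (W (γ t) j a * vel γ t)) =
        (γ t - z)⁻¹ * (vel γ t * ∑ a, W (γ t) j a * hR (γ t) a k) := by
      simp only [Finset.mul_sum]
      exact Finset.sum_congr rfl fun a _ => by ring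
    rw [hsumL, hsumR]
    refine HasDerivAt.congr_deriv
      (((hg.mul (hg.const_sub 1)).mul hd).mul ((hg.sub_const z).inv hne')) ?_
    simp only [Pi.mul_apply]
    field_simp
    linear_combination (γ t - z) * hpe'
  have hcont : ContinuousOn (fun s => γ s * (1 - γ s) * W (γ s) j k * (γ s - z)⁻¹) (Icc 0 1) :=
    (hW.continuousOn_mul hγ j k).mul hinv
  have hftc := intervalIntegral.integral_eq_sub_of_hasDerivAt_of_le zero_le_one hcont hderiv
    (((i3.add i4).sub (hw j k)).sub (i1.const_mul _))
  rw [intervalIntegral.integral_sub ((i3.add i4).sub (hw j k)) (i1.const_mul _),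
    intervalIntegral.integral_sub (i3.add i4) (hw j k), intervalIntegral.integral_add i3 i4,
    intervalIntegral.integral_finsetSum fun a _ => i2 _ (hhL j a) a k,
    intervalIntegral.integral_finsetSum fun a _ => i2 _ (hhR a k) j a,
    intervalIntegral.integral_const_mul, hγ.start, hγ.finish] at hftc
  linear_combination -hftc

/-- The Cauchy transform `c` of the weight satisfies the Pearson equation up to an entire
inhomogeneity: `z (1 - z) c' = hL c + c hR + R`. -/
lemma exists_entire_pearson_cauchyTransform (hγ : IsArc γ) (hW : IsJacobiType γ W)
    {hL hR : ℂ → Matrix (Fin N) (Fin N) ℂ} (hhL : HolomorphicOn hL Set.univ)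
    (hhR : HolomorphicOn hR Set.univ) (hP : PearsonEq γ W hL hR) :
    ∃ R : ℂ → Matrix (Fin N) (Fin N) ℂ, HolomorphicOn R Set.univ ∧
      ∀ z ∉ γ '' unitI, ∃ c' : Matrix (Fin N) (Fin N) ℂ,
        HasMDerivAt (cauchyTransform γ W) c' z ∧
        (z * (1 - z)) • c' =
          hL z * cauchyTransform γ W z + cauchyTransform γ W z * hR z + R z := by
  have hw := hW.intervalIntegrable hγ
  let κ : ℂ := (2 * (Real.pi : ℂ) * Complex.I)⁻¹
  refine ⟨fun z => Matrix.of fun j k => κ *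
    (∑ a, (∫ t in (0 : ℝ)..1, dslope (fun y => hL y j a) (γ t) z * (W (γ t) a k * vel γ t)) +
      ∑ a, (∫ t in (0 : ℝ)..1, dslope (fun y => hR y a k) (γ t) z * (W (γ t) j a * vel γ t)) -
      ∫ t in (0 : ℝ)..1, W (γ t) j k * vel γ t), fun j k => ?_, fun z hz => ?_⟩
  · refine Differentiable.differentiableOn ?_
    refine Differentiable.const_mul (Differentiable.sub_const (Differentiable.add ?_ ?_) _) _
    · exact Differentiable.fun_sum fun a _ =>
        differentiable_integral_dslope hγ.continuousOn (hw a k)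
        (differentiableOn_univ.1 (hhL j a))
    · exact Differentiable.fun_sum fun a _ =>
        differentiable_integral_dslope hγ.continuousOn (hw j a)
        (differentiableOn_univ.1 (hhR a k))
  · have hc : ∀ y a b, cauchyTransform γ W y a b =
        κ * ∫ t in (0 : ℝ)..1, (γ t - y)⁻¹ * (W (γ t) a b * vel γ t) := fun y a b => by
      simp only [cauchyTransform, arcIntegral, Matrix.of_apply, Matrix.smul_apply, smul_eq_mul,
        mul_assoc, κ]
    refine ⟨Matrix.of fun j k =>
      κ * ∫ t in (0 : ℝ)..1, ((γ t - z) ^ 2)⁻¹ * (W (γ t) j k * vel γ t), fun j k => ?_, ?_⟩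
    · simp only [hc]
      exact (hasDerivAt_integral_inv_sub hγ.continuousOn (hw j k) hz).const_mul κ
    · ext j k
      have hLe : ∀ a,
          ∫ t in (0 : ℝ)..1, (γ t - z)⁻¹ * (hL (γ t) j a * (W (γ t) a k * vel γ t)) = _ :=
        fun a => integral_inv_sub_mul_entire hγ.continuousOn (hw a k)
          (differentiableOn_univ.1 (hhL j a)) hz
      have hRe : ∀ a,
          ∫ t in (0 : ℝ)..1, (γ t - z)⁻¹ * (hR (γ t) a k * (W (γ t) j a * vel γ t)) = _ :=
        fun a => integral_inv_sub_mul_entire hγ.continuousOn (hw j a)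
          (differentiableOn_univ.1 (hhR a k)) hz
      have h := integral_pearson hγ hW hhL hhR hP hz j k
      simp only [hLe, hRe, Finset.sum_add_distrib] at h
      simp only [Matrix.smul_apply, Matrix.of_apply, Matrix.add_apply, Matrix.mul_apply, hc,
        smul_eq_mul]
      have h1 : ∑ a, hL z j a * (κ * ∫ t in (0 : ℝ)..1, (γ t - z)⁻¹ * (W (γ t) a k * vel γ t)) =
          κ * ∑ a, hL z j a * ∫ t in (0 : ℝ)..1, (γ t - z)⁻¹ * (W (γ t) a k * vel γ t) := by
        rw [Finset.mul_sum]
        exact Finset.sum_congr rfl fun a _ => by ring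
      have h2 : ∑ a, (κ * ∫ t in (0 : ℝ)..1, (γ t - z)⁻¹ * (W (γ t) j a * vel γ t)) * hR z a k =
          κ * ∑ a, hR z a k * ∫ t in (0 : ℝ)..1, (γ t - z)⁻¹ * (W (γ t) j a * vel γ t) := by
        rw [Finset.mul_sum]
        exact Finset.sum_congr rfl fun a _ => by ring
      rw [h1, h2]
      linear_combination κ * h

end Pearson

/-! ### Factorization of the fundamental matrices -/

section Factorization

open Matrix

variable {N : ℕ}

/-- The polynomial of the second kind attached to `P_n^L`. -/
noncomputable def EL (γ : ℝ → ℂ) (W : ℂ → Matrix (Fin N) (Fin N) ℂ) (n : ℕ) (z : ℂ) :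
    Matrix (Fin N) (Fin N) ℂ :=
  secondL (moment γ W) (monicCoeff (orthData γ W n).cL) n z

/-- The polynomial of the second kind attached to `P_n^R`. -/
noncomputable def ER (γ : ℝ → ℂ) (W : ℂ → Matrix (Fin N) (Fin N) ℂ) (n : ℕ) (z : ℂ) :
    Matrix (Fin N) (Fin N) ℂ :=
  secondR (moment γ W) (monicCoeff (orthData γ W n).cR) n z

/-- The matrix `Y_n^L` with the second kind functions replaced by the polynomials of the second
kind. -/
noncomputable def polyFactor (γ : ℝ → ℂ) (W : ℂ → Matrix (Fin N) (Fin N) ℂ) :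
    ℕ → ℂ → Matrix (Fin N ⊕ Fin N) (Fin N ⊕ Fin N) ℂ
  | 0, z => fromBlocks (PL γ W 0 z) (EL γ W 0 z) 0 1
  | n + 1, z => fromBlocks (PL γ W (n + 1) z) (EL γ W (n + 1) z)
      (-(Cmat γ W n * PL γ W n z)) (-(Cmat γ W n * EL γ W n z))

/-- The polynomial inverse of `polyFactor`, built from the right orthogonal polynomials. -/
noncomputable def polyFactorInv (γ : ℝ → ℂ) (W : ℂ → Matrix (Fin N) (Fin N) ℂ) :
    ℕ → ℂ → Matrix (Fin N ⊕ Fin N) (Fin N ⊕ Fin N) ℂ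
  | 0, z => fromBlocks 1 (-ER γ W 0 z) 0 (PR γ W 0 z)
  | n + 1, z => fromBlocks (-(ER γ W n z * Cmat γ W n)) (-ER γ W (n + 1) z)
      (PR γ W n z * Cmat γ W n) (PR γ W (n + 1) z)

/-- The symplectic unit `J`, which intertwines the left and the right problem. -/
def sympJ (N : ℕ) : Matrix (Fin N ⊕ Fin N) (Fin N ⊕ Fin N) ℂ := fromBlocks 0 1 (-1) 0

/-- The inverse of `sympJ`. -/
def sympJInv (N : ℕ) : Matrix (Fin N ⊕ Fin N) (Fin N ⊕ Fin N) ℂ := fromBlocks 0 (-1) 1 0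

lemma sympJ_mul_inv : sympJ N * sympJInv N = 1 := by
  simp [sympJ, sympJInv, fromBlocks_multiply]

lemma sympJInv_mul : sympJInv N * sympJ N = 1 := by
  simp [sympJ, sympJInv, fromBlocks_multiply]

lemma sympJ_conj (A B C D : Matrix (Fin N) (Fin N) ℂ) :
    sympJInv N * fromBlocks A B C D * sympJ N = fromBlocks D (-C) (-B) A := by
  simp [sympJ, sympJInv, fromBlocks_multiply]

variable {γ : ℝ → ℂ} {W : ℂ → Matrix (Fin N) (Fin N) ℂ}

lemma holomorphicOn_PL (n : ℕ) : HolomorphicOn (PL γ W n) Set.univ := by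
  have : PL γ W n = coeffPoly (monicCoeff (orthData γ W n).cL) n :=
    funext fun z => monicPoly_eq_coeffPoly _ z
  rw [this]
  exact holomorphicOn_coeffPoly _ _

lemma holomorphicOn_PR (n : ℕ) : HolomorphicOn (PR γ W n) Set.univ := by
  have : PR γ W n = coeffPoly (monicCoeff (orthData γ W n).cR) n :=
    funext fun z => monicPoly_eq_coeffPoly _ z
  rw [this]
  exact holomorphicOn_coeffPoly _ _

lemma holomorphicOn_polyFactor (n : ℕ) : HolomorphicOn (polyFactor γ W n) Set.univ := by
  have hE : ∀ n, HolomorphicOn (EL γ W n) Set.univ := fun n => holomorphicOn_secondL _ _ _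
  cases n with
  | zero =>
    exact (holomorphicOn_PL 0).fromBlocks (hE 0) (holomorphicOn_const 0 _)
      (holomorphicOn_const 1 _)
  | succ n =>
    exact (holomorphicOn_PL _).fromBlocks (hE _)
      ((holomorphicOn_const _ _).mul (holomorphicOn_PL n)).neg
      ((holomorphicOn_const _ _).mul (hE n)).neg

lemma holomorphicOn_polyFactorInv (n : ℕ) : HolomorphicOn (polyFactorInv γ W n) Set.univ := by
  have hE : ∀ n, HolomorphicOn (ER γ W n) Set.univ := fun n => holomorphicOn_secondR _ _ _
  cases n with
  | zero =>
    exact (holomorphicOn_const 1 _).fromBlocks (hE 0).neg (holomorphicOn_const 0 _)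
      (holomorphicOn_PR 0)
  | succ n =>
    exact ((hE n).mul (holomorphicOn_const _ _)).neg.fromBlocks (hE _).neg
      ((holomorphicOn_PR n).mul (holomorphicOn_const _ _)) (holomorphicOn_PR _)

/-- Biorthogonality of the left and right polynomials in matrix form. -/
lemma polyFactor_mul_inv (hγ : ContinuousOn γ unitI)
    (hW : ∀ j k, IntervalIntegrable (fun t => W (γ t) j k * vel γ t) volume 0 1)
    (hreg : IsRegularWeight γ W) (n : ℕ) (z : ℂ) :
    polyFactor γ W n z * polyFactorInv γ W n z = 1 := by
  have ho := isOrthoCoeff_orthData hγ hW hreg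
  have hself : ∀ n, EL γ W n z * PR γ W n z = PL γ W n z * ER γ W n z := fun n => by
    have := (ho n).wronskian_self z
    simpa only [EL, ER, PL, PR, monicPoly_eq_coeffPoly] using sub_eq_zero.1 this
  cases n with
  | zero =>
    have hL0 : PL γ W 0 z = 1 := by simp [PL, monicPoly]
    have hR0 : PR γ W 0 z = 1 := by simp [PR, monicPoly]
    have h := hself 0
    rw [hL0, hR0, Matrix.mul_one, Matrix.one_mul] at h
    simp [polyFactor, polyFactorInv, fromBlocks_multiply, hL0, hR0, h]
  | succ n =>
    have h1 : EL γ W (n + 1) z * PR γ W n z - PL γ W (n + 1) z * ER γ W n z = (Cmat γ W n)⁻¹ := by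
      simpa only [EL, ER, PL, PR, monicPoly_eq_coeffPoly] using
        (ho n).wronskian_succ_left (ho (n + 1)) z
    have h2 : EL γ W n z * PR γ W (n + 1) z - PL γ W n z * ER γ W (n + 1) z = -(Cmat γ W n)⁻¹ := by
      simpa only [EL, ER, PL, PR, monicPoly_eq_coeffPoly] using
        (ho n).wronskian_succ_right (ho (n + 1)) z
    have hu : IsUnit (Cmat γ W n).det := isUnit_iff_ne_zero.2 (ho n).det_ne_zero
    have e11 : PL γ W (n + 1) z * -(ER γ W n z * Cmat γ W n) +
        EL γ W (n + 1) z * (PR γ W n z * Cmat γ W n) = 1 := by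
      rw [Matrix.mul_neg, ← Matrix.mul_assoc, ← Matrix.mul_assoc, neg_add_eq_sub, ← Matrix.sub_mul,
        h1, Matrix.nonsing_inv_mul _ hu]
    have e12 : PL γ W (n + 1) z * -ER γ W (n + 1) z + EL γ W (n + 1) z * PR γ W (n + 1) z = 0 := by
      rw [hself, Matrix.mul_neg, neg_add_cancel]
    have e21 : -(Cmat γ W n * PL γ W n z) * -(ER γ W n z * Cmat γ W n) +
        -(Cmat γ W n * EL γ W n z) * (PR γ W n z * Cmat γ W n) = 0 := by
      have : Cmat γ W n * EL γ W n z * (PR γ W n z * Cmat γ W n) =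
          Cmat γ W n * (EL γ W n z * PR γ W n z) * Cmat γ W n := by
        simp only [Matrix.mul_assoc]
      rw [neg_mul_neg, Matrix.neg_mul, this, hself]
      simp only [Matrix.mul_assoc, add_neg_cancel]
    have e22 : -(Cmat γ W n * PL γ W n z) * -ER γ W (n + 1) z +
        -(Cmat γ W n * EL γ W n z) * PR γ W (n + 1) z = 1 := by
      rw [neg_mul_neg, Matrix.neg_mul, Matrix.mul_assoc, Matrix.mul_assoc, ← sub_eq_add_neg,
        ← Matrix.mul_sub, ← neg_sub, h2, neg_neg, Matrix.mul_nonsing_inv _ hu]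
    rw [polyFactor, polyFactorInv, fromBlocks_multiply, e11, e12, e21, e22, fromBlocks_one]

lemma YL_eq (hγ : ContinuousOn γ unitI)
    (hW : ∀ j k, IntervalIntegrable (fun t => W (γ t) j k * vel γ t) volume 0 1)
    {z : ℂ} (hz : z ∉ γ '' unitI) (n : ℕ) :
    YL γ W n z = polyFactor γ W n z * fromBlocks 1 (cauchyTransform γ W z) 0 1 := by
  cases n with
  | zero => simp [YL, polyFactor, fromBlocks_multiply, QL_eq hγ hW hz, EL]
  | succ n =>
    simp [YL, polyFactor, fromBlocks_multiply, QL_eq hγ hW hz, EL, Matrix.mul_add, Matrix.mul_assoc,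
      add_comm]

lemma YR_eq (hγ : ContinuousOn γ unitI)
    (hW : ∀ j k, IntervalIntegrable (fun t => W (γ t) j k * vel γ t) volume 0 1)
    {z : ℂ} (hz : z ∉ γ '' unitI) (n : ℕ) :
    YR γ W n z = sympJInv N *
      (fromBlocks 1 (-cauchyTransform γ W z) 0 1 * polyFactorInv γ W n z) * sympJ N := by
  cases n with
  | zero =>
    rw [YR, polyFactorInv, fromBlocks_multiply, sympJ_conj]
    simp [QR_eq hγ hW hz, ER, add_comm]
  | succ n =>
    rw [YR, polyFactorInv, fromBlocks_multiply, sympJ_conj]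
    simp [QR_eq hγ hW hz, ER, Matrix.add_mul, Matrix.mul_assoc, add_comm]

end Factorization

/-! ### The structure matrices -/

section Structure

open Matrix

lemma isOpen_cutPlane {γ : ℝ → ℂ} (hγ : ContinuousOn γ unitI) : IsOpen (cutPlane γ) := by
  have h1 : IsClosed (γ '' unitI) := (isCompact_Icc.image_of_continuousOn hγ).isClosed
  have h2 : IsClosed ((fun x : ℝ => (x : ℂ)) '' Ici 1) :=
    Complex.isometry_ofReal.isClosedEmbedding.isClosedMap _ isClosed_Ici
  have : cutPlane γ = (γ '' unitI)ᶜ ∩ ((fun x : ℝ => (x : ℂ)) '' Ici 1)ᶜ := by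
    ext z
    simp only [cutPlane, mem_ofPred_eq, mem_inter_iff, mem_compl_iff]
    refine and_congr Iff.rfl ⟨?_, fun h x hx hz => h ⟨x, hx, hz.symm⟩⟩
    rintro h ⟨x, hx, rfl⟩
    exact h x hx rfl
  rw [this]
  exact h1.isOpen_compl.inter h2.isOpen_compl

lemma extendsWithSimplePoles_of_eq {m : Type*} {M E : ℂ → Matrix m m ℂ} {D : Set ℂ}
    (hE : HolomorphicOn E Set.univ) (hM : ∀ z ∈ D, M z = (z * (1 - z))⁻¹ • E z) :
    ExtendsWithSimplePoles M D := by
  have hEa : ∀ i j z, AnalyticAt ℂ (fun z => E z i j) z := fun i j z =>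
    (differentiableOn_univ.1 (hE i j)).analyticAt z
  have hσ : ∀ z : ℂ, MeromorphicAt (fun z : ℂ => (z * (1 - z))⁻¹) z := fun z => by
    have : AnalyticAt ℂ (fun z : ℂ => z * (1 - z)) z := by fun_prop
    exact this.meromorphicAt.inv
  have ord0 : meromorphicOrderAt (fun z : ℂ => (z * (1 - z))⁻¹) 0 = ((-1 : ℤ) : WithTop ℤ) := by
    refine (meromorphicOrderAt_eq_int_iff (hσ 0)).2 ⟨fun z => (1 - z)⁻¹, ?_, by simp, ?_⟩
    · exact AnalyticAt.inv (by fun_prop) (by simp)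
    · exact Eventually.of_forall fun z => by simp [mul_comm]
  have ord1 : meromorphicOrderAt (fun z : ℂ => (z * (1 - z))⁻¹) 1 = ((-1 : ℤ) : WithTop ℤ) := by
    refine (meromorphicOrderAt_eq_int_iff (hσ 1)).2 ⟨fun z => (-z)⁻¹, ?_, by simp, ?_⟩
    · exact AnalyticAt.inv (by fun_prop) (by simp)
    · refine Eventually.of_forall fun z => ?_
      rw [_root_.zpow_neg_one, smul_eq_mul, ← mul_inv]
      congr 1
      ring
  have hord : ∀ i j (p : ℂ),
      meromorphicOrderAt (fun z : ℂ => (z * (1 - z))⁻¹) p = ((-1 : ℤ) : WithTop ℤ) →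
      -1 ≤ meromorphicOrderAt (fun z => ((z * (1 - z))⁻¹ • E z) i j) p := by
    intro i j p hp
    have h1 : (fun z => ((z * (1 - z))⁻¹ • E z) i j) =
        (fun z : ℂ => (z * (1 - z))⁻¹) * fun z => E z i j := rfl
    rw [h1, meromorphicOrderAt_mul (hσ p) (hEa i j p).meromorphicAt, hp]
    exact le_add_of_nonneg_right (hEa i j p).meromorphicOrderAt_nonneg
  refine ⟨fun z => (z * (1 - z))⁻¹ • E z, fun z hz => (hM z hz).symm, fun i j =>
    ⟨fun z _ => (hσ z).mul (hEa i j z).meromorphicAt, fun z hz => ?_, hord i j 0 ord0,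
      hord i j 1 ord1⟩, E, hE, fun z h0 h1 => ?_⟩
  · refine AnalyticAt.mul (AnalyticAt.inv (by fun_prop) ?_) (hEa i j z)
    simp only [mem_compl_iff, mem_insert_iff, mem_singleton_iff, not_or] at hz
    exact mul_ne_zero hz.1 (sub_ne_zero.2 (Ne.symm hz.2))
  · rw [smul_smul, mul_inv_cancel₀ (mul_ne_zero h0 (sub_ne_zero.2 h1.symm)), one_smul]

variable {N : ℕ} {γ : ℝ → ℂ} {W hL hR WL WR : ℂ → Matrix (Fin N) (Fin N) ℂ}

lemma cutPlane_weight_ne_zero (hγ : IsArc γ) {z : ℂ} (hz : z ∈ cutPlane γ) : z * (1 - z) ≠ 0 := by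
  refine mul_ne_zero ?_ (sub_ne_zero.2 ?_)
  · rintro rfl
    exact hz.1 ⟨0, left_mem_Icc.2 zero_le_one, hγ.start⟩
  · rintro rfl
    exact hz.1 ⟨1, right_mem_Icc.2 zero_le_one, hγ.finish⟩

/-- The non-polynomial factor of `Z_n^L` satisfies a linear differential system
`z (1 - z) V' = K V` with entire coefficient matrix `K`. -/
lemma hasMDerivAt_cauchyFactor (hγ : IsArc γ) (hfact : IsFactorization γ W hL hR WL WR) {z : ℂ}
    (hz : z ∈ cutPlane γ) {c' R : Matrix (Fin N) (Fin N) ℂ}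
    (hc : HasMDerivAt (cauchyTransform γ W) c' z)
    (hcR : (z * (1 - z)) • c' =
      hL z * cauchyTransform γ W z + cauchyTransform γ W z * hR z + R) :
    HasMDerivAt (fun y => fromBlocks (WL y) (cauchyTransform γ W y * (WR y)⁻¹) 0 (WR y)⁻¹)
      ((z * (1 - z))⁻¹ • (fromBlocks (hL z) R 0 (-hR z) *
        fromBlocks (WL z) (cauchyTransform γ W z * (WR z)⁻¹) 0 (WR z)⁻¹)) z := by
  have hopen := isOpen_cutPlane hγ.continuousOn
  have hσ := cutPlane_weight_ne_zero hγ hz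
  have hsolve : ∀ {A B : Matrix (Fin N) (Fin N) ℂ}, (z * (1 - z)) • A = B →
      A = (z * (1 - z))⁻¹ • B := fun h => by
    rw [← h, smul_smul, inv_mul_cancel₀ hσ, one_smul]
  have dL := hfact.holoL.hasMDerivAt hopen hz
  have dR := (hfact.holoR.hasMDerivAt hopen hz).inv (hfact.nonsingR z hz)
  have hu : (WR z)⁻¹ * WR z = 1 :=
    nonsing_inv_mul _ (isUnit_iff_ne_zero.2 (hfact.nonsingR z hz))
  rw [hsolve (hfact.pearsonL z hz)] at dL
  rw [hsolve (hfact.pearsonR z hz)] at dR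
  have hRinv : -((WR z)⁻¹ * ((z * (1 - z))⁻¹ • (WR z * hR z)) * (WR z)⁻¹) =
      (z * (1 - z))⁻¹ • (-(hR z) * (WR z)⁻¹) := by
    rw [Matrix.mul_smul, ← Matrix.mul_assoc, hu, Matrix.one_mul, Matrix.smul_mul, Matrix.neg_mul,
      smul_neg]
  rw [hRinv] at dR
  convert dL.fromBlocks (hc.mul dR) (hasMDerivAt_const 0 z) dR using 1
  rw [hsolve hcR, fromBlocks_multiply, fromBlocks_smul]
  congr 1
  · simp
  · rw [Matrix.smul_mul, Matrix.mul_smul, ← smul_add]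
    congr 1
    simp only [Matrix.add_mul, Matrix.neg_mul, Matrix.mul_neg, Matrix.mul_assoc]
    abel
  · simp
  · simp

end Structure

end JacobiRH

theorem mainTheorem2 {N : ℕ} (γ : ℝ → ℂ) (hγ : IsArc γ)
    (W hL hR WL WR : ℂ → Matrix (Fin N) (Fin N) ℂ)
    (hreg : IsRegularWeight γ W) (hjac : IsJacobiType γ W)
    (hhL : HolomorphicOn hL Set.univ) (hhR : HolomorphicOn hR Set.univ)
    (hpearson : PearsonEq γ W hL hR)
    (hfact : IsFactorization γ W hL hR WL WR) (n : ℕ) :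
    (HolomorphicOn (ZL γ W WL WR n) (cutPlane γ) ∧
      (∀ z ∈ cutPlane γ, (ZL γ W WL WR n z).det ≠ 0) ∧
      ExtendsWithSimplePoles (ML γ W WL WR n) (cutPlane γ)) ∧
    (HolomorphicOn (ZR γ W WL WR n) (cutPlane γ) ∧
      (∀ z ∈ cutPlane γ, (ZR γ W WL WR n z).det ≠ 0) ∧
      ExtendsWithSimplePoles (MR γ W WL WR n) (cutPlane γ)) := by
  have hint := hjac.intervalIntegrable hγ
  have hopen := isOpen_cutPlane hγ.continuousOn
  obtain ⟨R, hRhol, hRc⟩ := exists_entire_pearson_cauchyTransform hγ hjac hhL hhR hpearson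
  let c := cauchyTransform γ W
  let S := polyFactor γ W n
  let T := polyFactorInv γ W n
  let V := fun y => Matrix.fromBlocks (WL y) (c y * (WR y)⁻¹) 0 (WR y)⁻¹
  let K := fun y => Matrix.fromBlocks (hL y) (R y) 0 (-hR y)
  have hST : ∀ z, S z * T z = 1 := polyFactor_mul_inv hγ.continuousOn hint hreg n
  have hTS : ∀ z, T z * S z = 1 := fun z => mul_eq_one_comm.1 (hST z)
  have hS : HolomorphicOn S Set.univ := holomorphicOn_polyFactor n
  have hT : HolomorphicOn T Set.univ := holomorphicOn_polyFactorInv n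
  -- `z (1 - z) (Z_n^L)' = E Z_n^L` with `E` entire
  let E := fun z => (z * (1 - z)) • (mderiv S z * T z) + S z * K z * T z
  have hE : HolomorphicOn E Set.univ :=
    (HolomorphicOn.smul (by fun_prop) (hS.mderiv.mul hT)).add
      ((hS.mul (hhL.fromBlocks hRhol (holomorphicOn_const _ _) hhR.neg)).mul hT)
  have hZL : ∀ z ∈ cutPlane γ, ZL γ W WL WR n z = S z * V z := by
    intro z hz
    rw [ZL, YL_eq hγ.continuousOn hint hz.1, Matrix.mul_assoc, Matrix.fromBlocks_multiply]
    simp [S, V, c]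
  have hZLd : ∀ z ∈ cutPlane γ, HasMDerivAt (ZL γ W WL WR n)
      ((z * (1 - z))⁻¹ • (E z * ZL γ W WL WR n z)) z := by
    intro z hz
    have hσ := cutPlane_weight_ne_zero hγ hz
    obtain ⟨c', hc', hcR⟩ := hRc z hz.1
    have hV := hasMDerivAt_cauchyFactor hγ hfact hz hc' hcR
    have h := ((hS.hasMDerivAt isOpen_univ (mem_univ z)).mul hV).congr_of_eventuallyEq
      (Filter.eventuallyEq_of_mem (hopen.mem_nhds hz) hZL)
    convert h using 1
    rw [hZL z hz]
    have h1 : E z * (S z * V z) = (z * (1 - z)) • (mderiv S z * V z) + S z * (K z * V z) := by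
      have h2 : ∀ A, A * T z * (S z * V z) = A * V z := fun A => by
        rw [Matrix.mul_assoc, ← Matrix.mul_assoc (T z), hTS, Matrix.one_mul]
      simp only [E, Matrix.add_mul, Matrix.smul_mul, h2]
      rw [Matrix.mul_assoc (S z)]
    rw [h1, smul_add, smul_smul, inv_mul_cancel₀ hσ, one_smul, Matrix.mul_smul]
  -- the explicit inverse of `Z_n^L`, which is `Z_n^R` conjugated by `J`
  let X := fun z => Matrix.fromBlocks (WL z)⁻¹ 0 0 (WR z) *
    (Matrix.fromBlocks 1 (-c z) 0 1 * T z)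
  have hX : ∀ z ∈ cutPlane γ, ZL γ W WL WR n z * X z = 1 := by
    intro z hz
    have hLu : WL z * (WL z)⁻¹ = 1 :=
      Matrix.mul_nonsing_inv _ (isUnit_iff_ne_zero.2 (hfact.nonsingL z hz))
    have hRu : (WR z)⁻¹ * WR z = 1 :=
      Matrix.nonsing_inv_mul _ (isUnit_iff_ne_zero.2 (hfact.nonsingR z hz))
    have hVinv : V z * (Matrix.fromBlocks (WL z)⁻¹ 0 0 (WR z) *
        Matrix.fromBlocks 1 (-c z) 0 1) = 1 := by
      simp [V, Matrix.fromBlocks_multiply, hLu, hRu, Matrix.mul_assoc, ← Matrix.mul_assoc (WL z)]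
    have hX' : X z = Matrix.fromBlocks (WL z)⁻¹ 0 0 (WR z) *
        Matrix.fromBlocks 1 (-c z) 0 1 * T z := (Matrix.mul_assoc _ _ _).symm
    rw [hZL z hz, hX', Matrix.mul_assoc, ← Matrix.mul_assoc (V z), hVinv, Matrix.one_mul, hST]
  have hdet : ∀ z ∈ cutPlane γ, (ZL γ W WL WR n z).det ≠ 0 := fun z hz =>
    Matrix.det_ne_zero_of_right_inverse (hX z hz)
  have hZR : ∀ z ∈ cutPlane γ,
      ZR γ W WL WR n z = sympJInv N * (ZL γ W WL WR n z)⁻¹ * sympJ N := by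
    intro z hz
    rw [Matrix.inv_eq_right_inv (hX z hz), ZR, YR_eq hγ.continuousOn hint hz.1,
      show Matrix.fromBlocks (WR z) 0 0 (WL z)⁻¹ =
        sympJInv N * Matrix.fromBlocks (WL z)⁻¹ 0 0 (WR z) * sympJ N by simp [sympJ_conj]]
    simp only [X, Matrix.mul_assoc]
    rw [← Matrix.mul_assoc (sympJ N) (sympJInv N), sympJ_mul_inv, Matrix.one_mul]
  have hZRinv : ∀ z ∈ cutPlane γ,
      (sympJInv N * ZL γ W WL WR n z * sympJ N) * ZR γ W WL WR n z = 1 := by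
    intro z hz
    have hu := Matrix.mul_nonsing_inv _ (isUnit_iff_ne_zero.2 (hdet z hz))
    rw [hZR z hz]
    simp only [Matrix.mul_assoc]
    rw [← Matrix.mul_assoc (sympJ N) (sympJInv N), sympJ_mul_inv, Matrix.one_mul,
      ← Matrix.mul_assoc (ZL γ W WL WR n z), hu, Matrix.one_mul, sympJInv_mul]
  have hZRd : ∀ z ∈ cutPlane γ, HasMDerivAt (ZR γ W WL WR n)
      (-((z * (1 - z))⁻¹ • (sympJInv N * ((ZL γ W WL WR n z)⁻¹ * E z) * sympJ N))) z := by
    intro z hz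
    have hu := Matrix.mul_nonsing_inv _ (isUnit_iff_ne_zero.2 (hdet z hz))
    have h := (((hasMDerivAt_const (sympJInv N) z).mul ((hZLd z hz).inv (hdet z hz))).mul
      (hasMDerivAt_const (sympJ N) z)).congr_of_eventuallyEq
        (Filter.eventuallyEq_of_mem (hopen.mem_nhds hz) hZR)
    convert h using 1
    simp only [Matrix.zero_mul, zero_add, Matrix.mul_zero, add_zero, Matrix.mul_smul,
      Matrix.smul_mul, Matrix.mul_assoc, hu, Matrix.mul_one, Matrix.mul_neg, Matrix.neg_mul]
  refine ⟨⟨holomorphicOn_of_hasMDerivAt hZLd, hdet, extendsWithSimplePoles_of_eq hE ?_⟩,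
    holomorphicOn_of_hasMDerivAt hZRd,
    fun z hz => Matrix.det_ne_zero_of_left_inverse (hZRinv z hz),
    extendsWithSimplePoles_of_eq (E := fun z => -(sympJInv N * E z * sympJ N))
      (((holomorphicOn_const _ _).mul hE).mul (holomorphicOn_const _ _)).neg ?_⟩
  · intro z hz
    rw [ML, (hZLd z hz).mderiv, Matrix.smul_mul, Matrix.mul_assoc,
      Matrix.mul_nonsing_inv _ (isUnit_iff_ne_zero.2 (hdet z hz)), Matrix.mul_one]
  · intro z hz
    have hu := Matrix.mul_nonsing_inv _ (isUnit_iff_ne_zero.2 (hdet z hz))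
    rw [MR, (hZRd z hz).mderiv, Matrix.inv_eq_left_inv (hZRinv z hz), Matrix.mul_neg,
      Matrix.mul_smul, smul_neg]
    congr 2
    simp only [Matrix.mul_assoc]
    rw [← Matrix.mul_assoc (sympJ N) (sympJInv N), sympJ_mul_inv, Matrix.one_mul,
      ← Matrix.mul_assoc (ZL γ W WL WR n z), hu, Matrix.one_mul]
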